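/- Let $1\le M<T$ be integers and let $\gamma_D>\gamma_{CL}\ge 0$ be real numbers. Consider the block-fading $M\times M$ noncoherent MIMO channel with coherence time $T$: in each coherence period the received $M\times T$ matrix is $Y=GX+W$, where $X$ is the $M\times T$ matrix of transmitted symbols, $W$ has i.i.d. $\mathcal{CN}(0,1)$ entries, and $G$ is an $M\times M$ random matrix with independent entries, $g_{ii}\sim\mathcal{CN}(0,\mathsf{SNR}^{\gamma_D})$ and $g_{ij}\sim\mathcal{CN}(0,\mathsf{SNR}^{\gamma_{CL}})$ for $i\ne j$; $X,G,W$ are independent, and $G,W$ are independent from one period to the next and unknown to the transmitter and to the receiver. A rate $R$ (bits per symbol) is achievable by i.i.d. Gaussian codebooks if, with at least $2^{nTR}$ codewords over $n$ coherence periods, all of whose symbols, across antennas and time, are i.i.d. $\mathcal{CN}(0,1)$, there are decoders, knowing the codebook and the received signal, whose error probability, averaged over the messages and the random codebook, tends to $0$ as $n\to\infty$. A class of schemes achieves the generalized degrees of freedom (gDoF) $d$ if it achieves rates $R(\mathsf{SNR})$, for all large $\mathsf{SNR}$, with $R(\mathsf{SNR})/\log_2\mathsf{SNR}\to d$ as $\mathsf{SNR}\to\infty$.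 Then: (i) i.i.d. Gaussian codebooks achieve the gDoF $$M\left(\left(1-\frac1T\right)\gamma_D-\frac{M-1}{T}\gamma_{CL}\right).$$ (ii) Consider conventional training: codes of average power at most $1$ per antenna and symbol in which, in every coherence period, each transmit antenna sends a fixed known nonzero pilot in a symbol slot of its own while all other antennas are silent, so that $T-M$ slots are left for data. Every gDoF that such codes achieve (rates being counted per symbol, training symbols included) is at most $M\left(1-\frac MT\right)\gamma_D$, even if the receiver is given $G$ exactly. (iii) If $M\ge 2$, then $M\left(1-\frac MT\right)\gamma_D<M\left(\left(1-\frac1T\right)\gamma_D-\frac{M-1}{T}\gamma_{CL}\right)$, so the gDoF in (i) exceeds what conventional training achieves. -/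

import Mathlib

open MeasureTheory ProbabilityTheory Filter Topology
open scoped NNReal ENNReal

noncomputable section

/-- The circularly symmetric complex Gaussian law with mean `0` and variance `v`: the real and
imaginary parts are independent real centred Gaussians of variance `v / 2` each. -/
def complexGaussian (v : ℝ≥0) : Measure ℂ :=
  ((gaussianReal 0 (v / 2)).prod (gaussianReal 0 (v / 2))).map
    Complex.measurableEquivRealProd.symm

/-- Complex `m × n` matrices, with the product measurable structure. -/
abbrev CMatrix (m n : ℕ) : Type := Fin m → Fin n → ℂ

/-- The law of a random matrix with independent entries, the `(i, j)` entry being circularly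
symmetric complex Gaussian with mean `0` and variance `v i j`. -/
def gaussianMatrix {m n : ℕ} (v : Fin m → Fin n → ℝ≥0) : Measure (CMatrix m n) :=
  Measure.pi fun i => Measure.pi fun j => complexGaussian (v i j)

/-- The variances of the channel gains: `snr ^ γD` on the direct links (the diagonal) and
`snr ^ γCL` on the cross links. -/
def linkStrength (M : ℕ) (γD γCL snr : ℝ) (i j : Fin M) : ℝ≥0 :=
  Real.toNNReal (if i = j then snr ^ γD else snr ^ γCL)

/-- The law of the channel matrices in `n` coherence periods: independent from period to period. -/
def fadingLaw (M n : ℕ) (γD γCL snr : ℝ) : Measure (Fin n → CMatrix M M) :=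
  Measure.pi fun _ => gaussianMatrix (linkStrength M γD γCL snr)

/-- The law of the additive noise in `n` coherence periods of `T` symbols: i.i.d. standard complex
Gaussian entries. -/
def noiseLaw (M T n : ℕ) : Measure (Fin n → CMatrix M T) :=
  Measure.pi fun _ => gaussianMatrix fun _ _ => 1

/-- The received signal `Y = G X + W` in each of the `n` coherence periods. -/
def received {M T n : ℕ} (X : Fin n → CMatrix M T)
    (G : Fin n → CMatrix M M) (W : Fin n → CMatrix M T) :
    Fin n → CMatrix M T :=
  fun b i t => ∑ j, G b i j * X b j t + W b i t

/-- A codebook of `K` codewords, each extending over `n` coherence periods of `T` symbols. -/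
abbrev Codebook (M T n K : ℕ) : Type :=
  Fin K → Fin n → CMatrix M T

/-- The i.i.d. Gaussian random codebook: all symbols of all codewords, across antennas and time,
are independent standard complex Gaussians (so the average power per antenna and symbol is `1`). -/
def gaussianCodebookLaw (M T n K : ℕ) : Measure (Codebook M T n K) :=
  Measure.pi fun _ => Measure.pi fun _ => gaussianMatrix fun _ _ => 1

/-- The error probability of a decoder which knows the codebook and the received signal, but not
the channel matrices, for a uniformly distributed message, averaged over the i.i.d. Gaussian
codebook, the fading and the noise. -/
def gaussianCodebookError (M T n K : ℕ) (γD γCL snr : ℝ)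
    (decoder : Codebook M T n K → (Fin n → CMatrix M T) → Fin K) : ℝ≥0∞ :=
  (K : ℝ≥0∞)⁻¹ * ∑ m : Fin K,
    ((gaussianCodebookLaw M T n K).prod ((fadingLaw M n γD γCL snr).prod (noiseLaw M T n)))
      {ω | decoder ω.1 (received (ω.1 m) ω.2.1 ω.2.2) ≠ m}

/-- The rate `R`, in bits per symbol, is achievable over the noncoherent channel by i.i.d. Gaussian
codebooks: with at least `2 ^ (n T R)` codewords over `n` coherence periods, the error probability
tends to `0` as `n → ∞`. -/
def GaussianCodebooksAchieveRate (M T : ℕ) (γD γCL snr R : ℝ) : Prop :=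
  ∃ (K : ℕ → ℕ)
    (decoder : ∀ n, Codebook M T n (K n) → (Fin n → CMatrix M T) → Fin (K n)),
    (∀ n : ℕ, (2 : ℝ) ^ ((n : ℝ) * T * R) ≤ K n) ∧
    (∀ n, Measurable (Function.uncurry (decoder n))) ∧
    Tendsto (fun n => gaussianCodebookError M T n (K n) γD γCL snr (decoder n)) atTop (𝓝 0)

/-- A code with conventional training, with `K` codewords over `n` coherence periods of `T`
symbols. In every period each transmit antenna `j` has its own symbol slot `slot j`, in which
it alone transmits, and what it transmits is a known pilot; the other `T - M` slots are free for
data. The average power per antenna and symbol is at most `1`. The decoder is given the exact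
channel matrices besides the received signal; this idealizes the training, and decoders which
only use the received signal are included. -/
structure TrainingCode (M T n K : ℕ) where
  codebook : Codebook M T n K
  slot : Fin M ↪ Fin T
  pilot : Fin M → ℂ
  pilot_ne_zero : ∀ j, pilot j ≠ 0
  codebook_slot : ∀ m b i j, codebook m b i (slot j) = if i = j then pilot j else 0
  power_le : ∑ m, ∑ b, ∑ i, ∑ t, ‖codebook m b i t‖ ^ 2 ≤ (K : ℝ) * n * M * T
  decoder : (Fin n → CMatrix M T) × (Fin n → CMatrix M M) → Fin K
  measurable_decoder : Measurable decoder

/-- The error probability of a code with training, for a uniformly distributed message. -/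
def TrainingCode.error {M T n K : ℕ} (c : TrainingCode M T n K) (γD γCL snr : ℝ) : ℝ≥0∞ :=
  (K : ℝ≥0∞)⁻¹ * ∑ m : Fin K,
    ((fadingLaw M n γD γCL snr).prod (noiseLaw M T n))
      {ω | c.decoder (received (c.codebook m) ω.1 ω.2, ω.1) ≠ m}

/-- The rate `R`, in bits per symbol (the training symbols are counted), is achievable by codes
with conventional training. -/
def TrainingAchievesRate (M T : ℕ) (γD γCL snr R : ℝ) : Prop :=
  ∃ (K : ℕ → ℕ) (code : ∀ n, TrainingCode M T n (K n)),
    (∀ n : ℕ, (2 : ℝ) ^ ((n : ℝ) * T * R) ≤ K n) ∧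
    Tendsto (fun n => (code n).error γD γCL snr) atTop (𝓝 0)

/-- The generalized degrees of freedom `d` are achieved, where `achievesRate snr R` says that the
rate `R` is achievable at the signal-to-noise ratio `snr`: some achievable rates `R snr` satisfy
`R snr / log₂ snr → d` as `snr → ∞`. -/
def AchievesGDoF (achievesRate : ℝ → ℝ → Prop) (d : ℝ) : Prop :=
  ∃ R : ℝ → ℝ, (∀ᶠ snr in atTop, achievesRate snr (R snr)) ∧
    Tendsto (fun snr => R snr / Real.logb 2 snr) atTop (𝓝 d)

end

/-! Achievability rests on a test applied to each coherence period, not on mutual information. The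
channel matrix is rounded to a matrix `Z` of Gaussian integers; outside rare events `Z` lies in a
finite list of diagonally dominant matrices and `Y` is within a polylogarithmic distance of `Z X`
(`closeTest_compl_le`). With amplitudes `a = snr ^ (γD / 2)` and `c = snr ^ (γCL / 2)`, the list has
at most about `a ^ (2 M) * c ^ (2 M (M - 1))` elements up to powers of `log snr`. Dominance makes
each `Z` expand distances by about `a` (`norm_sub_le_of_dominant`), so an independent Gaussian input
fits a given `Z` with probability about `a ^ (-2 M T)`. The union bound over the list
(`gaussianMatrix_closeTest_le`) gives an exponent `M ((T - 1) γD - (M - 1) γCL)` per period;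
division by `T` gives the gDoF. Accepting the codewords that pass in nearly all periods turns the
test into a code (`exists_decoder_error_le`); the polylogarithmic losses vanish against `log snr`.

The converse is a volume argument conditional on `G`. Pilot slots have the same law for every
message, and in the other slots the density of `Y` is at most `1 / π` per coordinate. Decoding
regions are disjoint, so the correct-decoding probabilities at bounded received energy sum to at
most a volume of order `snr ^ (n M (T - M) γD)` (`sum_correct_le`), while Markov's inequality and
the power constraint bound the energy (`TrainingCode.sum_energy_gt_le`). Hence the number of
codewords is limited (`TrainingCode.one_le_error_add`). The gap between the two expressions is `M (M
- 1) (γD - γCL) / T`. -/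

instance complexGaussian.instIsProbabilityMeasure (v : ℝ≥0) :
    IsProbabilityMeasure (complexGaussian v) :=
  Measure.isProbabilityMeasure_map Complex.measurableEquivRealProd.symm.measurable.aemeasurable

instance gaussianMatrix.instIsProbabilityMeasure {m n : ℕ} (v : Fin m → Fin n → ℝ≥0) :
    IsProbabilityMeasure (gaussianMatrix v) := by
  unfold gaussianMatrix; infer_instance

instance fadingLaw.instIsProbabilityMeasure (M n : ℕ) (γD γCL snr : ℝ) :
    IsProbabilityMeasure (fadingLaw M n γD γCL snr) := by
  unfold fadingLaw; infer_instance

instance noiseLaw.instIsProbabilityMeasure (M T n : ℕ) :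
    IsProbabilityMeasure (noiseLaw M T n) := by
  unfold noiseLaw; infer_instance

instance gaussianCodebookLaw.instIsProbabilityMeasure (M T n K : ℕ) :
    IsProbabilityMeasure (gaussianCodebookLaw M T n K) := by
  unfold gaussianCodebookLaw; infer_instance

/-! ### Product measures. -/

/-- **Tonelli's theorem** for products of functions of the separate coordinates. -/
theorem lintegral_pi_prod {E : Type*} [MeasurableSpace E] {n : ℕ} (μ : Fin n → Measure E)
    [∀ i, SigmaFinite (μ i)] (f : Fin n → E → ℝ≥0∞) (hf : ∀ i, Measurable (f i)) :
    ∫⁻ x, ∏ i, f i (x i) ∂(Measure.pi μ) = ∏ i, ∫⁻ x, f i x ∂(μ i) := by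
  induction n with
  | zero => simp
  | succ n ih =>
    have h := (measurePreserving_piFinSuccAbove μ 0).symm
    rw [← h.lintegral_comp_emb (MeasurableEquiv.measurableEmbedding _)]
    simp only [Fin.prod_univ_succ, MeasurableEquiv.piFinSuccAbove_symm_apply,
      Fin.insertNthEquiv_zero, Fin.consEquiv_apply, Fin.cons_zero, Fin.cons_succ,
      Fin.zero_succAbove]
    have h2 := lintegral_prod_mul (μ := μ 0) (ν := Measure.pi fun j : Fin n => μ j.succ)
      (f := f 0) (g := fun x => ∏ i : Fin n, f i.succ (x i)) (hf 0).aemeasurable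
      (Finset.measurable_fun_prod _ fun i _ => (hf _).comp (measurable_pi_apply i)).aemeasurable
    rw [ih (fun j => μ j.succ) (fun j => f j.succ) (fun j => hf _)] at h2
    exact h2

/-- The product outer measure is the largest one bounded by the products of side measures, and these
products are monotone; no σ-finiteness is needed. -/
theorem measure_pi_mono {ι : Type*} [Fintype ι] {E : ι → Type*} [∀ i, MeasurableSpace (E i)]
    {μ ν : ∀ i, Measure (E i)} (h : ∀ i, μ i ≤ ν i) : Measure.pi μ ≤ Measure.pi ν := by
  refine Measure.le_iff.2 fun s hs => ?_
  rw [Measure.pi, Measure.pi, toMeasure_apply _ _ hs, toMeasure_apply _ _ hs]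
  refine (OuterMeasure.le_boundedBy.2 fun t => (OuterMeasure.boundedBy_le t).trans ?_) s
  exact Finset.prod_le_prod' fun i _ => h i _

/-! ### Density, small-ball and tail bounds for complex Gaussians. -/

theorem gaussianReal_le_volume {v : ℝ≥0} (hv : v ≠ 0) :
    gaussianReal 0 v ≤ ENNReal.ofReal (√(2 * Real.pi * v))⁻¹ • volume := by
  rw [gaussianReal_of_var_ne_zero 0 hv, ← withDensity_const]
  refine withDensity_mono (ae_of_all _ fun x => ENNReal.ofReal_le_ofReal ?_)
  rw [gaussianPDFReal]
  refine mul_le_of_le_one_right (by positivity) (Real.exp_le_one_iff.2 ?_)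
  have : 0 ≤ (x - 0) ^ 2 / (2 * (v : ℝ)) := by positivity
  rw [neg_div]; linarith

/-- The density of a complex Gaussian of variance `v` is at most `1 / (π v)`. -/
theorem complexGaussian_le_volume {v : ℝ≥0} (hv : v ≠ 0) :
    complexGaussian v ≤ ENNReal.ofReal (1 / (Real.pi * v)) • volume := by
  have hv2 : v / 2 ≠ 0 := by positivity
  have hc : ENNReal.ofReal (1 / (Real.pi * v)) = ENNReal.ofReal (√(2 * Real.pi * (v / 2 : ℝ≥0)))⁻¹ *
      ENNReal.ofReal (√(2 * Real.pi * (v / 2 : ℝ≥0)))⁻¹ := by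
    rw [← ENNReal.ofReal_mul (by positivity), ← mul_inv, Real.mul_self_sqrt (by positivity)]
    congr 1
    push_cast
    field_simp
  have h1 := Measure.prod_mono (gaussianReal_le_volume hv2) (gaussianReal_le_volume hv2)
  rw [Measure.prod_smul_left, Measure.prod_smul_right, smul_smul, ← hc] at h1
  have h2 := Measure.map_mono h1 Complex.measurableEquivRealProd.symm.measurable
  rw [Measure.map_smul] at h2
  have h3 := Complex.volume_preserving_equiv_real_prod.symm.map_eq
  rw [Measure.volume_eq_prod] at h3
  rw [h3] at h2
  exact h2

theorem complexGaussian_closedBall_le {v : ℝ≥0} (hv : v ≠ 0) (a : ℂ) {r : ℝ} (hr : 0 ≤ r) :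
    complexGaussian v (Metric.closedBall a r) ≤ ENNReal.ofReal (r ^ 2 / v) := by
  refine (complexGaussian_le_volume hv _).trans ?_
  rw [Measure.smul_apply, Complex.volume_closedBall, smul_eq_mul, ← ENNReal.ofReal_pow hr,
    ← NNReal.coe_real_pi, ← ENNReal.ofReal_coe_nnreal (p := NNReal.pi),
    ← ENNReal.ofReal_mul (by positivity), ← ENNReal.ofReal_mul (by positivity)]
  refine ENNReal.ofReal_le_ofReal (le_of_eq ?_)
  have : (0 : ℝ) < v := by positivity
  have := NNReal.pi_pos
  field_simp

theorem lintegral_sq_gaussianReal (v : ℝ≥0) :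
    ∫⁻ x, ENNReal.ofReal (x ^ 2) ∂(gaussianReal 0 v) = v := by
  have h := evariance_eq_lintegral_ofReal id (gaussianReal 0 v)
  simp only [id, integral_id_gaussianReal, sub_zero] at h
  rw [← h, ← ENNReal.ofReal_coe_nnreal, ← variance_id_gaussianReal (μ := 0),
    MemLp.ofReal_variance_eq (memLp_id_gaussianReal 2)]

/-- The mean square of a complex Gaussian of variance `v` is `v`. -/
theorem lintegral_sq_complexGaussian (v : ℝ≥0) :
    ∫⁻ z, ENNReal.ofReal (‖z‖ ^ 2) ∂(complexGaussian v) = v := by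
  rw [complexGaussian, lintegral_map_equiv]
  have h : ∀ p : ℝ × ℝ, ENNReal.ofReal (‖Complex.measurableEquivRealProd.symm p‖ ^ 2) =
      ENNReal.ofReal (p.1 ^ 2) * 1 + 1 * ENNReal.ofReal (p.2 ^ 2) := fun p => by
    rw [Complex.sq_norm, Complex.normSq_apply, mul_one, one_mul,
      ← ENNReal.ofReal_add (by positivity) (by positivity)]
    simp [pow_two]
  have hm : Measurable fun x : ℝ => ENNReal.ofReal (x ^ 2) := by fun_prop
  simp only [h]
  rw [lintegral_add_left (by fun_prop),
    lintegral_prod_mul (f := fun x : ℝ => ENNReal.ofReal (x ^ 2)) (g := fun _ : ℝ => 1)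
      hm.aemeasurable (by fun_prop),
    lintegral_prod_mul (g := fun x : ℝ => ENNReal.ofReal (x ^ 2)) (f := fun _ : ℝ => 1)
      (by fun_prop) hm.aemeasurable, lintegral_sq_gaussianReal]
  simp [ENNReal.add_halves, ENNReal.coe_div]

/-- **Chebyshev's inequality** for a complex Gaussian. -/
theorem complexGaussian_norm_gt_le (v : ℝ≥0) {r : ℝ} (hr : 0 < r) :
    complexGaussian v {z | r < ‖z‖} ≤ ENNReal.ofReal (v / r ^ 2) := by
  have hm : Measurable fun z : ℂ => ENNReal.ofReal (‖z‖ ^ 2) := by fun_prop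
  have h := meas_ge_le_lintegral_div (μ := complexGaussian v) hm.aemeasurable
    (ε := ENNReal.ofReal (r ^ 2)) (by simp; positivity) (by simp)
  rw [lintegral_sq_complexGaussian] at h
  rw [ENNReal.ofReal_div_of_pos (by positivity), ENNReal.ofReal_coe_nnreal]
  refine (measure_mono fun z hz => ?_).trans h
  exact ENNReal.ofReal_le_ofReal (pow_le_pow_left₀ hr.le (le_of_lt hz) 2)

theorem measurePreserving_eval_gaussianMatrix {m n : ℕ} (v : Fin m → Fin n → ℝ≥0) (i : Fin m)
    (j : Fin n) :
    MeasurePreserving (fun A : CMatrix m n => A i j) (gaussianMatrix v) (complexGaussian (v i j)) :=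
  (measurePreserving_eval (fun j => complexGaussian (v i j)) j).comp
    (measurePreserving_eval (fun i => Measure.pi fun j => complexGaussian (v i j)) i)

/-! ### Chernoff bound and random coding. -/

/-- A **Chernoff bound** for the number of coordinates of a random vector with independent
coordinates which lie in given sets of probability at most `q`. -/
theorem pi_count_ge_le {E : Type*} [MeasurableSpace E] (μ : Measure E) [IsProbabilityMeasure μ]
    {n : ℕ} {A : Fin n → Set E} (hA : ∀ b, MeasurableSet (A b)) {q z : ℝ} (hq : 0 ≤ q)
    (hμ : ∀ b, μ (A b) ≤ ENNReal.ofReal q) (hz : 1 ≤ z) (δ : ℝ) :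
    Measure.pi (fun _ : Fin n => μ) {ω | δ * n ≤ ∑ b, (A b).indicator 1 (ω b)} ≤
      ENNReal.ofReal (((1 + q * z) * z ^ (-δ)) ^ n) := by
  have hz0 : 0 < z := by linarith
  have hm : ∀ b, Measurable fun x => ENNReal.ofReal (z ^ (A b).indicator (1 : E → ℝ) x) := by
    intro b
    have : Measurable ((A b).indicator (1 : E → ℝ)) := measurable_one.indicator (hA b)
    fun_prop
  have hint : ∀ b, ∫⁻ x, ENNReal.ofReal (z ^ (A b).indicator (1 : E → ℝ) x) ∂μ ≤
      ENNReal.ofReal (1 + q * z) := by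
    intro b
    -- The pointwise bound `z ^ 1_A ≤ 1 + z * 1_A` is crude on `A` (`1 + z` for `z`), but costs only
    -- constants later.
    calc _ ≤ ∫⁻ x, (1 + ENNReal.ofReal z * (A b).indicator 1 x) ∂μ := by
          refine lintegral_mono fun x => ?_
          by_cases hx : x ∈ A b <;> simp [hx]
      _ = 1 + ENNReal.ofReal z * μ (A b) := by
          rw [lintegral_add_left measurable_const, lintegral_const_mul _
            (measurable_one.indicator (hA b)), lintegral_indicator_one (hA b)]
          simp
      _ ≤ 1 + ENNReal.ofReal z * ENNReal.ofReal q := by gcongr; exact hμ b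
      _ = _ := by
          rw [← ENNReal.ofReal_mul hz0.le, ← ENNReal.ofReal_one,
            ← ENNReal.ofReal_add zero_le_one (by positivity), mul_comm z q]
  -- Markov's inequality for `z ^ count`, whose mean factorizes over the coordinates.
  have hmk := meas_ge_le_lintegral_div (μ := Measure.pi fun _ : Fin n => μ)
    (Finset.measurable_fun_prod Finset.univ
      fun b _ => (hm b).comp (measurable_pi_apply b)).aemeasurable
    (ε := ENNReal.ofReal (z ^ (δ * n))) (by simp; positivity) (by simp)
  have hpi := lintegral_pi_prod (fun _ : Fin n => μ)
    (fun b x => ENNReal.ofReal (z ^ (A b).indicator (1 : E → ℝ) x)) hm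
  simp only [Function.comp_apply] at hmk
  rw [hpi] at hmk
  refine (measure_mono fun ω hω => ?_).trans (hmk.trans ?_)
  · simp only [Set.mem_ofPred_eq] at hω ⊢
    rw [← ENNReal.ofReal_prod_of_nonneg (fun _ _ => by positivity), ← Real.rpow_sum_of_pos hz0]
    exact ENNReal.ofReal_le_ofReal (Real.rpow_le_rpow_of_exponent_le hz hω)
  · rw [ENNReal.div_eq_inv_mul, ← ENNReal.ofReal_inv_of_pos (by positivity)]
    calc _ ≤ ENNReal.ofReal (z ^ (δ * n))⁻¹ * ∏ _b : Fin n, ENNReal.ofReal (1 + q * z) := by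
          gcongr; exact hint _
      _ = _ := by
          rw [Finset.prod_const, Finset.card_univ, Fintype.card_fin,
            ← ENNReal.ofReal_pow (by positivity), ← ENNReal.ofReal_mul (by positivity), mul_pow,
            mul_comm, ← Real.rpow_neg hz0.le, ← Real.rpow_mul_natCast hz0.le, neg_mul]

section RandomCoding

variable {X Y Ω : Type*} [MeasurableSpace X] [MeasurableSpace Y] [MeasurableSpace Ω]

/-- The number of positions in which a codeword and a received word pass the test `B`. -/
noncomputable def passCount (B : Set (X × Y)) {n : ℕ} (x : Fin n → X) (y : Fin n → Y) : ℝ :=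
  ∑ b, B.indicator 1 (x b, y b)

theorem measurable_passCount {B : Set (X × Y)} (hB : MeasurableSet B) {n : ℕ} {α : Type*}
    [MeasurableSpace α] {f : α → Fin n → X} {g : α → Fin n → Y} (hf : Measurable f)
    (hg : Measurable g) : Measurable fun a => passCount B (f a) (g a) := by
  refine Finset.measurable_fun_sum _ fun b _ => (measurable_one.indicator hB).comp ?_
  exact ((measurable_pi_apply b).comp hf).prodMk ((measurable_pi_apply b).comp hg)

/-- The transmitted codeword passes the test in few positions with small probability only. -/
theorem passCount_sent_lt_le (P : Measure X) [IsProbabilityMeasure P] (μ : Measure Ω)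
    [IsProbabilityMeasure μ] {φ : X × Ω → Y} (hφ : Measurable φ) {B : Set (X × Y)}
    (hB : MeasurableSet B) {q : ℝ} (hq0 : 0 ≤ q)
    (hq : (P.prod μ) {ω | (ω.1, φ ω) ∉ B} ≤ ENNReal.ofReal q) (δ : ℝ) (n : ℕ) :
    ((Measure.pi fun _ : Fin n => P).prod (Measure.pi fun _ : Fin n => μ))
        {ω | passCount B ω.1 (fun b => φ (ω.1 b, ω.2 b)) < (1 - δ) * n} ≤
      ENNReal.ofReal (Real.exp (3 * q - δ) ^ n) := by
  have hA : MeasurableSet {ω : X × Ω | (ω.1, φ ω) ∉ B} :=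
    (measurable_fst.prodMk hφ) hB.compl
  -- Failures are counted, with `z = e`; since `e < 3`, the factor `1 + q e` is at most `exp (3 q)`.
  have h := pi_count_ge_le (P.prod μ) (n := n) (A := fun _ => {ω | (ω.1, φ ω) ∉ B})
    (fun _ => hA) hq0 (fun _ => hq) (Real.one_le_exp zero_le_one) δ
  have hmp := measurePreserving_arrowProdEquivProdArrow X Ω (Fin n) (fun _ => P) (fun _ => μ)
  rw [← hmp.measure_preimage_emb (MeasurableEquiv.measurableEmbedding _)]
  refine (measure_mono fun ω hω => ?_).trans (h.trans (ENNReal.ofReal_le_ofReal ?_))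
  · have hω' : ∑ b, B.indicator (1 : X × Y → ℝ) ((ω b).1, φ (ω b)) < (1 - δ) * n := hω
    have h1 : ∀ b, ({ω : X × Ω | (ω.1, φ ω) ∉ B}.indicator 1 (ω b) : ℝ) =
        1 - B.indicator (1 : X × Y → ℝ) ((ω b).1, φ (ω b)) := fun b => by
      by_cases hb : ((ω b).1, φ (ω b)) ∈ B <;> simp [Set.indicator, hb]
    simp only [Set.mem_ofPred_eq, h1, Finset.sum_sub_distrib, Finset.sum_const, Finset.card_univ,
      Fintype.card_fin, nsmul_eq_mul, mul_one]
    linarith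
  · refine pow_le_pow_left₀ (by positivity) ?_ n
    rw [sub_eq_add_neg, Real.exp_add, ← Real.exp_mul, one_mul]
    gcongr
    have := Real.add_one_le_exp (3 * q)
    nlinarith [Real.exp_one_lt_three]

/-- An independent codeword passes the test in many positions with small probability only. -/
theorem passCount_other_ge_le (P : Measure X) [IsProbabilityMeasure P] {B : Set (X × Y)}
    (hB : MeasurableSet B) {p : ℝ} (hp0 : 0 < p) (hp1 : p ≤ 1)
    (hp : ∀ y, P {x | (x, y) ∈ B} ≤ ENNReal.ofReal p) (δ : ℝ) {n : ℕ} (y : Fin n → Y) :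
    (Measure.pi fun _ : Fin n => P) {x | (1 - δ) * n ≤ passCount B x y} ≤
      ENNReal.ofReal ((2 * p ^ (1 - δ)) ^ n) := by
  -- The choice `z = 1 / p` makes `1 + p z = 2`.
  have h := pi_count_ge_le P (n := n) (A := fun b => {x | (x, y b) ∈ B})
    (fun b => measurable_prodMk_right hB) hp0.le (fun b => hp (y b)) ((one_le_inv₀ hp0).2 hp1)
    (1 - δ)
  refine h.trans (le_of_eq ?_)
  rw [mul_inv_cancel₀ hp0.ne', Real.inv_rpow hp0.le, ← Real.rpow_neg hp0.le, neg_neg]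
  norm_num

/-- Makes a competing codeword independent of the transmitted one, hence of the received word. -/
theorem measurePreserving_eval_pair {ι : Type*} [Fintype ι] {α : Type*} [MeasurableSpace α]
    (ν : Measure α) [IsProbabilityMeasure ν] {i j : ι} (hij : i ≠ j) :
    MeasurePreserving (fun x : ι → α => (x i, x j)) (Measure.pi fun _ => ν) (ν.prod ν) := by
  refine ⟨by fun_prop, ?_⟩
  have h := (iIndepFun_pi (μ := fun _ : ι => ν) (X := fun _ x => x)
    fun _ => aemeasurable_id').indepFun hij
  have h2 := (indepFun_iff_map_prod_eq_prod_map_map (measurable_pi_apply i).aemeasurable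
    (measurable_pi_apply j).aemeasurable).1 h
  have hi := (measurePreserving_eval (fun _ : ι => ν) i).map_eq
  have hj := (measurePreserving_eval (fun _ : ι => ν) j).map_eq
  unfold Function.eval at hi hj
  rwa [hi, hj] at h2

/-- **Random coding** over a memoryless channel `φ` with input law `P` and noise law `μ`: a test `B`
which holds for the input and the output with probability at least `1 - q`, and for an independent
input with probability at most `p` whatever the output, gives a decoder. -/
theorem exists_decoder_error_le (P : Measure X) [IsProbabilityMeasure P] (μ : Measure Ω)
    [IsProbabilityMeasure μ] {φ : X × Ω → Y} (hφ : Measurable φ) {B : Set (X × Y)}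
    (hB : MeasurableSet B) {q p : ℝ} (hq0 : 0 ≤ q) (hp0 : 0 < p) (hp1 : p ≤ 1)
    (hq : (P.prod μ) {ω | (ω.1, φ ω) ∉ B} ≤ ENNReal.ofReal q)
    (hp : ∀ y, P {x | (x, y) ∈ B} ≤ ENNReal.ofReal p) (δ : ℝ) (n : ℕ) {K : ℕ} (hK : 0 < K) :
    ∃ decoder : (Fin K → Fin n → X) → (Fin n → Y) → Fin K,
      Measurable (Function.uncurry decoder) ∧ ∀ m,
        ((Measure.pi fun _ : Fin K => Measure.pi fun _ : Fin n => P).prod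
            (Measure.pi fun _ : Fin n => μ))
            {ω | decoder ω.1 (fun b => φ (ω.1 m b, ω.2 b)) ≠ m} ≤
          ENNReal.ofReal (Real.exp (3 * q - δ) ^ n + (K - 1) * (2 * p ^ (1 - δ)) ^ n) := by
  classical
  -- Any accepted message will do; the default when none is accepted is harmless, because the
  -- transmitted codeword has then failed the test.
  let select : (Fin K → Prop) → Fin K := fun s => if h : ∃ m, s m then h.choose else ⟨0, hK⟩
  let accepted : (Fin K → Fin n → X) → (Fin n → Y) → Fin K → Prop :=
    fun c y m => (1 - δ) * n ≤ passCount B (c m) y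
  have hselect : ∀ s m, select s ≠ m → ¬ s m ∨ ∃ m' ≠ m, s m' := by
    intro s m h
    by_cases hs : ∃ m, s m
    · refine Or.inr ⟨select s, h, ?_⟩
      simp only [select, hs, dif_pos]
      exact hs.choose_spec
    · exact Or.inl fun h' => hs ⟨m, h'⟩
  have hselm : Measurable select := .of_discrete
  refine ⟨fun c y => select (accepted c y), ?_, fun m => ?_⟩
  · refine hselm.comp (measurable_pi_iff.2 fun m => ?_)
    refine measurableSet_setOfPred.1 (measurableSet_le measurable_const ?_)
    exact measurable_passCount hB ((measurable_pi_apply m).comp measurable_fst) measurable_snd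
  set Q := Measure.pi fun _ : Fin n => P
  set N := Measure.pi fun _ : Fin n => μ
  have hφn : Measurable fun ω : (Fin n → X) × (Fin n → Ω) => fun b => φ (ω.1 b, ω.2 b) := by
    fun_prop
  have hsent : ((Measure.pi fun _ : Fin K => Q).prod N)
      {ω | passCount B (ω.1 m) (fun b => φ (ω.1 m b, ω.2 b)) < (1 - δ) * n} ≤
        ENNReal.ofReal (Real.exp (3 * q - δ) ^ n) := by
    have hmp := (measurePreserving_eval (fun _ : Fin K => Q) m).prod (MeasurePreserving.id N)
    refine le_trans (le_of_eq ?_) (passCount_sent_lt_le P μ hφ hB hq0 hq δ n)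
    exact hmp.measure_preimage (measurableSet_lt (measurable_passCount hB measurable_fst hφn)
      measurable_const).nullMeasurableSet
  have hother : ∀ m' ≠ m, ((Measure.pi fun _ : Fin K => Q).prod N)
      {ω | (1 - δ) * n ≤ passCount B (ω.1 m') (fun b => φ (ω.1 m b, ω.2 b))} ≤
        ENNReal.ofReal ((2 * p ^ (1 - δ)) ^ n) := by
    intro m' hm'
    have hmp := (measurePreserving_prodAssoc Q Q N).comp
      ((measurePreserving_eval_pair Q hm').prod (MeasurePreserving.id N))
    have hS : MeasurableSet {z : (Fin n → X) × (Fin n → X) × (Fin n → Ω) |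
        (1 - δ) * n ≤ passCount B z.1 (fun b => φ (z.2.1 b, z.2.2 b))} :=
      measurableSet_le measurable_const
        (measurable_passCount hB measurable_fst (hφn.comp measurable_snd))
    refine (hmp.measure_preimage hS.nullMeasurableSet).le.trans ?_
    -- The competitor is integrated first, with the transmitted codeword and the noise, hence the
    -- output, held fixed.
    rw [Measure.prod_apply_symm hS]
    have hle := lintegral_mono (μ := Q.prod N)
      (fun z => passCount_other_ge_le P hB hp0 hp1 hp δ (n := n) fun b => φ (z.1 b, z.2 b))
    refine hle.trans (le_of_eq ?_)
    simp
  calc _ ≤ ((Measure.pi fun _ : Fin K => Q).prod N)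
        ({ω | passCount B (ω.1 m) (fun b => φ (ω.1 m b, ω.2 b)) < (1 - δ) * n} ∪
          ⋃ m' ∈ Finset.univ.erase m,
            {ω | (1 - δ) * n ≤ passCount B (ω.1 m') (fun b => φ (ω.1 m b, ω.2 b))}) := by
        refine measure_mono fun ω hω => ?_
        rcases hselect _ _ hω with h | ⟨m', hm', h⟩
        · exact Or.inl (not_le.1 h)
        · exact Or.inr (Set.mem_biUnion (by simpa using hm') h)
    _ ≤ ENNReal.ofReal (Real.exp (3 * q - δ) ^ n) +
          ∑ _m' ∈ Finset.univ.erase m, ENNReal.ofReal ((2 * p ^ (1 - δ)) ^ n) := by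
        refine (measure_union_le _ _).trans (add_le_add hsent ?_)
        refine (measure_biUnion_finset_le _ _).trans (Finset.sum_le_sum fun m' h => ?_)
        exact hother m' (Finset.ne_of_mem_erase h)
    _ = _ := by
        have hK1 : (1 : ℝ) ≤ K := by exact_mod_cast hK
        rw [ENNReal.ofReal_add (by positivity) (mul_nonneg (by linarith) (by positivity)),
          ENNReal.ofReal_mul (by linarith), Finset.sum_const, Finset.card_erase_of_mem (by simp),
          Finset.card_univ, Fintype.card_fin, nsmul_eq_mul, ← ENNReal.ofReal_natCast,
          Nat.cast_sub hK, Nat.cast_one]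

end RandomCoding

/-! ### Quantization of the channel matrix. -/

/-- The Gaussian integer with given real and imaginary parts, as a complex number. -/
def gaussianInt (z : ℤ × ℤ) : ℂ := ⟨z.1, z.2⟩

/-- Rounding down the real and the imaginary part. -/
noncomputable def complexFloor (z : ℂ) : ℤ × ℤ := (⌊z.re⌋, ⌊z.im⌋)

theorem norm_sub_complexFloor_le (z : ℂ) : ‖z - gaussianInt (complexFloor z)‖ ≤ 2 := by
  refine (Complex.norm_le_abs_re_add_abs_im _).trans ?_
  have h1 : |Int.fract z.re| ≤ 1 := by
    rw [abs_of_nonneg (Int.fract_nonneg _)]; exact (Int.fract_lt_one _).le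
  have h2 : |Int.fract z.im| ≤ 1 := by
    rw [abs_of_nonneg (Int.fract_nonneg _)]; exact (Int.fract_lt_one _).le
  simp only [gaussianInt, complexFloor, Complex.sub_re, Complex.sub_im]
  rw [Int.self_sub_floor, Int.self_sub_floor]
  linarith

theorem floor_mem_Icc {x A : ℝ} (h : |x| ≤ A) : ⌊x⌋ ∈ Finset.Icc (-(⌊A⌋ + 1)) (⌊A⌋ + 1) := by
  obtain ⟨h1, h2⟩ := abs_le.1 h
  rw [Finset.mem_Icc]
  have h3 : ⌊x⌋ ≤ ⌊A⌋ := Int.floor_le_floor h2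
  -- A negative number may be rounded down past `-⌊A⌋`; this is why the box extends to `⌊A⌋ + 1`.
  refine ⟨?_, by omega⟩
  rw [Int.le_floor]
  push_cast
  have := Int.lt_floor_add_one A
  linarith

/-- The Gaussian integers with real and imaginary part at most `⌊A⌋ + 1` in absolute value. -/
noncomputable def gaussianIntBox (A : ℝ) : Finset (ℤ × ℤ) :=
  Finset.Icc (-(⌊A⌋ + 1)) (⌊A⌋ + 1) ×ˢ Finset.Icc (-(⌊A⌋ + 1)) (⌊A⌋ + 1)

theorem complexFloor_mem_gaussianIntBox {z : ℂ} {A : ℝ} (h : ‖z‖ ≤ A) :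
    complexFloor z ∈ gaussianIntBox A :=
  Finset.mk_mem_product (floor_mem_Icc ((Complex.abs_re_le_norm z).trans h))
    (floor_mem_Icc ((Complex.abs_im_le_norm z).trans h))

theorem card_gaussianIntBox_le {A : ℝ} (hA : 1 ≤ A) :
    ((gaussianIntBox A).card : ℝ) ≤ (5 * A) ^ 2 := by
  have hA0 : 0 ≤ ⌊A⌋ := Int.floor_nonneg.2 (by linarith)
  have h : ((Finset.Icc (-(⌊A⌋ + 1)) (⌊A⌋ + 1)).card : ℝ) ≤ 5 * A := by
    rw [Int.card_Icc]
    have h2 : (((⌊A⌋ + 1 + 1 - -(⌊A⌋ + 1)).toNat : ℤ) : ℝ) = 2 * ⌊A⌋ + 3 := by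
      rw [Int.toNat_of_nonneg (by omega)]
      push_cast
      ring
    rw [Int.cast_natCast] at h2
    rw [h2]
    have := Int.floor_le A
    linarith
  rw [gaussianIntBox, Finset.card_product, Nat.cast_mul, pow_two]
  exact mul_le_mul h h (by positivity) (by positivity)

/-- The matrices of Gaussian integers with entries bounded by `A` whose rows are diagonally dominant
by at least `κ`. -/
noncomputable def dominantMatrices {M : ℕ} (A : Fin M → Fin M → ℝ) (κ : ℝ) :
    Finset (Fin M → Fin M → ℤ × ℤ) :=
  open scoped Classical in
  (Fintype.piFinset fun i => Fintype.piFinset fun j => gaussianIntBox (A i j)).filter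
    fun Z => ∀ i, κ + ∑ j ∈ Finset.univ.erase i, ‖gaussianInt (Z i j)‖ ≤ ‖gaussianInt (Z i i)‖

theorem card_dominantMatrices_le {M : ℕ} {A : Fin M → Fin M → ℝ} (hA : ∀ i j, 1 ≤ A i j) (κ : ℝ) :
    ((dominantMatrices A κ).card : ℝ) ≤ ∏ i, ∏ j, (5 * A i j) ^ 2 := by
  classical
  refine (Nat.cast_le.2 (Finset.card_filter_le _ _)).trans ?_
  simp only [Fintype.card_piFinset]
  push_cast
  gcongr with i _ j _
  exact card_gaussianIntBox_le (hA i j)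

/-- A diagonally dominant linear system determines its solution up to an error controlled by the
error of the right-hand side. -/
theorem norm_sub_le_of_dominant {M : ℕ} {A : Fin M → Fin M → ℂ} {κ r : ℝ} (hκ : 0 < κ)
    (hA : ∀ i, κ + ∑ j ∈ Finset.univ.erase i, ‖A i j‖ ≤ ‖A i i‖) {x x' y : Fin M → ℂ}
    (hx : ∀ i, ‖y i - ∑ j, A i j * x j‖ ≤ r) (hx' : ∀ i, ‖y i - ∑ j, A i j * x' j‖ ≤ r)
    (j : Fin M) : ‖x j - x' j‖ ≤ 2 * r / κ := by
  -- Row `i` is used where the coordinate difference is largest: there the off-diagonal terms cannot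
  -- cancel the diagonal one.
  obtain ⟨i, -, hi⟩ := Finset.exists_max_image Finset.univ (fun j => ‖x j - x' j‖) ⟨j, by simp⟩
  refine (hi j (by simp)).trans ((le_div_iff₀ hκ).2 ?_)
  have h1 : ‖∑ j, A i j * (x j - x' j)‖ ≤ 2 * r := by
    have : ∑ j, A i j * (x j - x' j) =
        (y i - ∑ j, A i j * x' j) - (y i - ∑ j, A i j * x j) := by
      simp only [mul_sub, Finset.sum_sub_distrib]; ring
    rw [this]
    exact (norm_sub_le _ _).trans (by linarith [hx i, hx' i])
  rw [← Finset.add_sum_erase _ _ (Finset.mem_univ i)] at h1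
  have h2 : ‖∑ j ∈ Finset.univ.erase i, A i j * (x j - x' j)‖ ≤
      (∑ j ∈ Finset.univ.erase i, ‖A i j‖) * ‖x i - x' i‖ := by
    rw [Finset.sum_mul]
    refine norm_sum_le_of_le _ fun k _ => ?_
    rw [norm_mul]
    exact mul_le_mul_of_nonneg_left (hi k (by simp)) (norm_nonneg _)
  have h3 := norm_sub_le (A i i * (x i - x' i) + ∑ j ∈ Finset.univ.erase i, A i j * (x j - x' j))
    (∑ j ∈ Finset.univ.erase i, A i j * (x j - x' j))
  rw [add_sub_cancel_right, norm_mul] at h3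
  nlinarith [hA i, norm_nonneg (x i - x' i)]

/-! ### The single-period test and its two error probabilities. -/

/-- The test for the input and the output of the channel in one coherence period: the output is
within `r` of `Z x` for some matrix `Z` of the list. -/
def closeTest (M T : ℕ) (S : Finset (Fin M → Fin M → ℤ × ℤ)) (r : ℝ) :
    Set (CMatrix M T × CMatrix M T) :=
  ⋃ Z ∈ S, {ω | ∀ i t, ‖ω.2 i t - ∑ j, gaussianInt (Z i j) * ω.1 j t‖ ≤ r}

theorem measurableSet_closeTest (M T : ℕ) (S : Finset (Fin M → Fin M → ℤ × ℤ)) (r : ℝ) :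
    MeasurableSet (closeTest M T S r) := by
  refine Finset.measurableSet_biUnion _ fun Z _ => ?_
  simp only [Set.ofPred_forall]
  refine MeasurableSet.iInter fun i => MeasurableSet.iInter fun t => ?_
  exact measurableSet_le (by fun_prop) measurable_const

/-- Whatever the output, a Gaussian input passes the test with small probability only. -/
theorem gaussianMatrix_closeTest_le {M T : ℕ} {A : Fin M → Fin M → ℝ} (hA : ∀ i j, 1 ≤ A i j)
    {κ r : ℝ} (hκ : 0 < κ) (hr : 0 ≤ r) (y : CMatrix M T) :
    gaussianMatrix (fun _ _ => 1) {x : CMatrix M T | (x, y) ∈ closeTest M T (dominantMatrices A κ) r}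
      ≤ ENNReal.ofReal ((∏ i, ∏ j, (5 * A i j) ^ 2) * ((2 * r / κ) ^ 2) ^ (M * T)) := by
  classical
  have hZ : ∀ Z ∈ dominantMatrices A κ, gaussianMatrix (fun _ _ => 1)
      {x : CMatrix M T | ∀ i t, ‖y i t - ∑ j, gaussianInt (Z i j) * x j t‖ ≤ r} ≤
        ENNReal.ofReal (((2 * r / κ) ^ 2) ^ (M * T)) := by
    intro Z hZ
    -- One solution `x₀` serves as centre: all others lie in a polydisc around it, so `Z` need not
    -- be inverted.
    obtain hE | ⟨x₀, hx₀⟩ := Set.eq_empty_or_nonempty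
      {x : CMatrix M T | ∀ i t, ‖y i t - ∑ j, gaussianInt (Z i j) * x j t‖ ≤ r}
    · rw [hE, measure_empty]; exact zero_le
    calc _ ≤ gaussianMatrix (fun _ _ => 1) (Set.univ.pi fun i => Set.univ.pi fun t =>
              Metric.closedBall (x₀ i t) (2 * r / κ)) := by
          refine measure_mono fun x hx => ?_
          simp only [Set.mem_univ_pi, mem_closedBall_iff_norm]
          intro j t
          exact norm_sub_le_of_dominant hκ (A := fun i j => gaussianInt (Z i j))
            (Finset.mem_filter.1 hZ).2 (fun i => hx i t) (fun i => hx₀ i t) j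
      _ = ∏ i, ∏ t, complexGaussian 1 (Metric.closedBall (x₀ i t) (2 * r / κ)) := by
          simp only [gaussianMatrix, Measure.pi_pi]
      _ ≤ ∏ _i : Fin M, ∏ _t : Fin T, ENNReal.ofReal ((2 * r / κ) ^ 2) := by
          gcongr
          refine (complexGaussian_closedBall_le one_ne_zero _ (by positivity)).trans ?_
          simp
      _ = _ := by
          simp only [Finset.prod_const, Finset.card_univ, Fintype.card_fin]
          rw [← pow_mul, mul_comm T M, ENNReal.ofReal_pow (by positivity),
            ENNReal.ofReal_pow (by positivity), ENNReal.ofReal_pow (by positivity)]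
  have hset : {x : CMatrix M T | (x, y) ∈ closeTest M T (dominantMatrices A κ) r} =
      ⋃ Z ∈ dominantMatrices A κ,
        {x : CMatrix M T | ∀ i t, ‖y i t - ∑ j, gaussianInt (Z i j) * x j t‖ ≤ r} := by
    ext x; simp [closeTest]
  rw [hset]
  refine (measure_biUnion_finset_le _ _).trans ((Finset.sum_le_sum hZ).trans ?_)
  rw [Finset.sum_const, nsmul_eq_mul, ← ENNReal.ofReal_natCast,
    ← ENNReal.ofReal_mul (Nat.cast_nonneg _)]
  exact ENNReal.ofReal_le_ofReal
    (mul_le_mul_of_nonneg_right (card_dominantMatrices_le hA κ) (by positivity))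

/-- The input and the output pass the test when no channel gain, symbol or noise sample is
exceptionally large and no direct link is in a deep fade. -/
theorem mem_closeTest {M T : ℕ} {L a c : ℝ} (hL : 1 ≤ L) (hc : 0 ≤ c)
    (hdom : a / (2 * L) + 2 + M * (L * c + 2) ≤ a / L) {x w : CMatrix M T} {g : CMatrix M M}
    (hx : ∀ j t, ‖x j t‖ ≤ L) (hw : ∀ i t, ‖w i t‖ ≤ L) (hd : ∀ i, a / L ≤ ‖g i i‖)
    (hg : ∀ i j, ‖g i j‖ ≤ L * if i = j then a else c) :
    (x, fun i t => ∑ j, g i j * x j t + w i t) ∈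
      closeTest M T (dominantMatrices (fun i j => L * if i = j then a else c) (a / (2 * L)))
        ((2 * M + 1) * L) := by
  classical
  -- The witness is the entrywise rounding of `g`. Rounding moves each entry by at most `2`, which
  -- `hdom` absorbs while leaving the margin `a / (2 * L)`.
  refine Set.mem_biUnion (x := fun i j => complexFloor (g i j)) ?_ ?_
  · refine Finset.mem_coe.2 (Finset.mem_filter.2 ⟨?_, fun i => ?_⟩)
    · simp only [Fintype.mem_piFinset]
      exact fun i j => complexFloor_mem_gaussianIntBox (hg i j)
    · have h1 : ∑ j ∈ Finset.univ.erase i, ‖gaussianInt (complexFloor (g i j))‖ ≤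
          M * (L * c + 2) := by
        have h0 : 0 ≤ L * c + 2 := by positivity
        calc _ ≤ ∑ j ∈ Finset.univ.erase i, (L * c + 2) := by
              refine Finset.sum_le_sum fun j hj => ?_
              have h2 := hg i j
              rw [if_neg (Finset.ne_of_mem_erase hj).symm] at h2
              have h3 := norm_sub_norm_le (gaussianInt (complexFloor (g i j))) (g i j)
              rw [norm_sub_rev] at h3
              linarith [norm_sub_complexFloor_le (g i j)]
          _ ≤ ∑ j : Fin M, (L * c + 2) :=
              Finset.sum_le_sum_of_subset_of_nonneg (Finset.erase_subset _ _) fun _ _ _ => h0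
          _ = _ := by simp [mul_add]
      have h4 := norm_sub_norm_le (g i i) (gaussianInt (complexFloor (g i i)))
      linarith [norm_sub_complexFloor_le (g i i), hd i]
  · intro i t
    -- The residual is `(g - Z) x + w`, of size at most `M * (2 * L) + L`.
    have h1 : ∑ j, g i j * x j t + w i t - ∑ j, gaussianInt (complexFloor (g i j)) * x j t =
        ∑ j, (g i j - gaussianInt (complexFloor (g i j))) * x j t + w i t := by
      simp only [sub_mul, Finset.sum_sub_distrib]; ring
    dsimp only
    rw [h1]
    have h2 : ‖∑ j, (g i j - gaussianInt (complexFloor (g i j))) * x j t‖ ≤ ∑ _j : Fin M, 2 * L := by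
      refine norm_sum_le_of_le _ fun j _ => ?_
      rw [norm_mul]
      exact mul_le_mul (norm_sub_complexFloor_le _) (hx j t) (norm_nonneg _) zero_le_two
    rw [Finset.sum_const, Finset.card_univ, Fintype.card_fin, nsmul_eq_mul] at h2
    linarith [norm_add_le (∑ j, (g i j - gaussianInt (complexFloor (g i j))) * x j t) (w i t),
      hw i t]

/-- The input and the output of the channel pass the test with high probability. -/
theorem closeTest_compl_le {M T : ℕ} {L a c : ℝ} (hL : 1 ≤ L) (ha : 0 < a) (hc : 0 < c)
    (hdom : a / (2 * L) + 2 + M * (L * c + 2) ≤ a / L) {v : Fin M → Fin M → ℝ≥0}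
    (hv : ∀ i j, (v i j : ℝ) = (if i = j then a else c) ^ 2) :
    ((gaussianMatrix fun _ _ => 1 : Measure (CMatrix M T)).prod ((gaussianMatrix v).prod
        (gaussianMatrix fun _ _ => 1 : Measure (CMatrix M T))))
      {ω | (ω.1, fun i t => ∑ j, ω.2.1 i j * ω.1 j t + ω.2.2 i t) ∉
        closeTest M T (dominantMatrices (fun i j => L * if i = j then a else c) (a / (2 * L)))
          ((2 * M + 1) * L)} ≤ ENNReal.ofReal ((2 * (M * T) + M + M * M) / L ^ 2) := by
  set P : Measure (CMatrix M T) := gaussianMatrix fun _ _ => 1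
  set μ := P.prod ((gaussianMatrix v).prod P)
  have hL0 : 0 < L := by linarith
  have hσ : ∀ i j : Fin M, 0 < if i = j then a else c := fun i j => by split_ifs <;> assumption
  -- Every exceptional event has probability at most `1 / L ^ 2`: `M T` for the symbols, `M T` for
  -- the noise, `M ^ 2` for large gains and `M` for deep fades.
  set e := ENNReal.ofReal (1 / L ^ 2) with he
  have hX : ∀ i t, μ {ω | L < ‖ω.1 i t‖} ≤ e := fun i t => by
    have hmp := (measurePreserving_eval_gaussianMatrix (fun _ _ => 1 : Fin M → Fin T → ℝ≥0) i t).comp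
      (measurePreserving_fst (μ := P) (ν := (gaussianMatrix v).prod P))
    have := complexGaussian_norm_gt_le 1 hL0
    rw [← hmp.measure_preimage (by measurability)] at this
    simpa [he] using this
  have hW : ∀ i t, μ {ω | L < ‖ω.2.2 i t‖} ≤ e := fun i t => by
    have hmp := (measurePreserving_eval_gaussianMatrix (fun _ _ => 1 : Fin M → Fin T → ℝ≥0) i t).comp
      ((measurePreserving_snd (μ := gaussianMatrix v) (ν := P)).comp
      (measurePreserving_snd (μ := P) (ν := (gaussianMatrix v).prod P)))
    have := complexGaussian_norm_gt_le 1 hL0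
    rw [← hmp.measure_preimage (by measurability)] at this
    simpa [he] using this
  have hmpG : ∀ i j, MeasurePreserving (fun ω : CMatrix M T × CMatrix M M × CMatrix M T =>
      ω.2.1 i j) μ (complexGaussian (v i j)) := fun i j =>
    (measurePreserving_eval_gaussianMatrix v i j).comp
      ((measurePreserving_fst (μ := gaussianMatrix v) (ν := P)).comp
      (measurePreserving_snd (μ := P) (ν := (gaussianMatrix v).prod P)))
  have hG : ∀ i j, μ {ω | (L * if i = j then a else c) < ‖ω.2.1 i j‖} ≤ e := fun i j => by
    have := complexGaussian_norm_gt_le (v i j) (mul_pos hL0 (hσ i j))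
    rw [← (hmpG i j).measure_preimage (by measurability), hv, mul_pow,
      div_mul_cancel_right₀ (by have := hσ i j; positivity), ← one_div] at this
    exact this
  -- A deep fade is bounded by the small-ball estimate; the variance `a ^ 2` cancels.
  have hD : ∀ i, μ {ω | ‖ω.2.1 i i‖ < a / L} ≤ e := fun i => by
    have hvi := hv i i
    rw [if_pos rfl] at hvi
    have := complexGaussian_closedBall_le (v := v i i) (fun h => by
      rw [h] at hvi; exact (pow_pos ha 2).ne hvi) 0 (div_nonneg ha.le hL0.le)
    rw [← (hmpG i i).measure_preimage measurableSet_closedBall.nullMeasurableSet, hvi, div_pow,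
      div_div_cancel_left' (by positivity), ← one_div] at this
    refine (measure_mono fun ω hω => ?_).trans this
    simpa using le_of_lt hω
  have hsub : {ω : CMatrix M T × CMatrix M M × CMatrix M T |
      (ω.1, fun i t => ∑ j, ω.2.1 i j * ω.1 j t + ω.2.2 i t) ∉
        closeTest M T (dominantMatrices (fun i j => L * if i = j then a else c) (a / (2 * L)))
          ((2 * M + 1) * L)} ⊆
      (⋃ i, ⋃ t, {ω | L < ‖ω.1 i t‖}) ∪ ((⋃ i, ⋃ t, {ω | L < ‖ω.2.2 i t‖}) ∪
        ((⋃ i, {ω | ‖ω.2.1 i i‖ < a / L}) ∪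
          ⋃ i, ⋃ j, {ω | (L * if i = j then a else c) < ‖ω.2.1 i j‖})) := by
    intro ω hω
    by_contra hcon
    simp only [Set.mem_union, Set.mem_iUnion, Set.mem_ofPred_eq, not_or, not_exists, not_lt] at hcon
    exact hω (mem_closeTest hL hc.le hdom hcon.1 hcon.2.1 hcon.2.2.1 hcon.2.2.2)
  have hsum : ∀ {k l : ℕ} {S : Fin k → Fin l → Set (CMatrix M T × CMatrix M M × CMatrix M T)},
      (∀ i t, μ (S i t) ≤ e) → μ (⋃ i, ⋃ t, S i t) ≤ k * l * e := by
    intro k l S h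
    calc _ ≤ ∑ i, ∑ t, μ (S i t) := (measure_iUnion_fintype_le _ _).trans
          (Finset.sum_le_sum fun i _ => measure_iUnion_fintype_le _ _)
      _ ≤ ∑ _i : Fin k, ∑ _t : Fin l, e := by gcongr; exact h _ _
      _ = _ := by simp [mul_assoc]
  have hsum1 : μ (⋃ i, {ω | ‖ω.2.1 i i‖ < a / L}) ≤ M * e := by
    refine (measure_iUnion_fintype_le _ _).trans ((Finset.sum_le_sum fun i _ => hD i).trans ?_)
    simp
  calc _ ≤ M * T * e + (M * T * e + (M * e + M * M * e)) := by
        refine (measure_mono hsub).trans ((measure_union_le _ _).trans (add_le_add (hsum hX) ?_))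
        refine (measure_union_le _ _).trans (add_le_add (hsum hW) ?_)
        exact (measure_union_le _ _).trans (add_le_add hsum1 (hsum hG))
    _ = ((2 * (M * T) + M + M * M : ℕ) : ℝ≥0∞) * e := by push_cast; ring
    _ = _ := by
        rw [he, ← ENNReal.ofReal_natCast, ← ENNReal.ofReal_mul (Nat.cast_nonneg _)]
        push_cast
        rw [mul_one_div]

/-! ### From the test to achievable rates and the gDoF. -/

theorem measurable_received {M T n : ℕ} {α : Type*} [MeasurableSpace α]
    {f : α → Fin n → CMatrix M T} {g : α → Fin n → CMatrix M M} {h : α → Fin n → CMatrix M T}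
    (hf : Measurable f) (hg : Measurable g) (hh : Measurable h) :
    Measurable fun a => received (f a) (g a) (h a) := by
  unfold received
  fun_prop

/-- The error is a sum of two geometric sequences: `hδ` makes the missed-detection term decay, and
`hR` keeps the number of codewords below the inverse of the confusion probability. -/
theorem gaussianCodebooksAchieveRate_of_test {M T : ℕ} {γD γCL snr : ℝ}
    {B : Set (CMatrix M T × CMatrix M T)} (hB : MeasurableSet B) {q p δ R : ℝ} (hq0 : 0 ≤ q)
    (hp0 : 0 < p) (hp1 : p ≤ 1)
    (hq : ((gaussianMatrix fun _ _ => 1 : Measure (CMatrix M T)).prod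
      ((gaussianMatrix (linkStrength M γD γCL snr)).prod
        (gaussianMatrix fun _ _ => 1 : Measure (CMatrix M T))))
      {ω | (ω.1, fun i t => ∑ j, ω.2.1 i j * ω.1 j t + ω.2.2 i t) ∉ B} ≤ ENNReal.ofReal q)
    (hp : ∀ y, gaussianMatrix (fun _ _ => 1) {x : CMatrix M T | (x, y) ∈ B} ≤ ENNReal.ofReal p)
    (hδ : 3 * q < δ) (hR : T * R = (1 - δ) * (-Real.logb 2 p) - 2) :
    GaussianCodebooksAchieveRate M T γD γCL snr R := by
  set K : ℕ → ℕ := fun n => ⌈(2 : ℝ) ^ ((n : ℝ) * T * R)⌉₊ with hK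
  have hKpos : ∀ n, 0 < K n := fun n => Nat.ceil_pos.2 (by positivity)
  set P : Measure (CMatrix M T) := gaussianMatrix fun _ _ => 1
  set G := gaussianMatrix (linkStrength M γD γCL snr)
  let φ : CMatrix M T × CMatrix M M × CMatrix M T → CMatrix M T :=
    fun ω i t => ∑ j, ω.2.1 i j * ω.1 j t + ω.2.2 i t
  have hφ : Measurable φ := by fun_prop
  choose decoder hdec herr using fun n =>
    exists_decoder_error_le P (G.prod P) hφ hB hq0 hp0 hp1 hq hp δ n (hKpos n)
  refine ⟨K, decoder, fun n => Nat.le_ceil _, hdec, ?_⟩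
  have hE : ∀ n, gaussianCodebookError M T n (K n) γD γCL snr (decoder n) ≤
      ENNReal.ofReal (Real.exp (3 * q - δ) ^ n + (1 / 2) ^ n) := by
    intro n
    have hm : ∀ m, ((gaussianCodebookLaw M T n (K n)).prod
        ((fadingLaw M n γD γCL snr).prod (noiseLaw M T n)))
        {ω | decoder n ω.1 (received (ω.1 m) ω.2.1 ω.2.2) ≠ m} ≤
          ENNReal.ofReal (Real.exp (3 * q - δ) ^ n + (1 / 2) ^ n) := by
      intro m
      have hmp := (MeasurePreserving.id (gaussianCodebookLaw M T n (K n))).prod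
        (measurePreserving_arrowProdEquivProdArrow (CMatrix M M) (CMatrix M T) (Fin n)
          (fun _ => G) (fun _ => P))
      have hS : MeasurableSet {ω : Codebook M T n (K n) × (Fin n → CMatrix M M) ×
          (Fin n → CMatrix M T) | decoder n ω.1 (received (ω.1 m) ω.2.1 ω.2.2) ≠ m} := by
        have h1 : Measurable fun ω : Codebook M T n (K n) × (Fin n → CMatrix M M) ×
          (Fin n → CMatrix M T) => decoder n ω.1 (received (ω.1 m) ω.2.1 ω.2.2) :=
          (hdec n).comp (measurable_fst.prodMk (measurable_received
            ((measurable_pi_apply m).comp measurable_fst) (measurable_fst.comp measurable_snd)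
            (measurable_snd.comp measurable_snd)))
        exact h1 (measurableSet_singleton m).compl
      refine (hmp.measure_preimage hS.nullMeasurableSet).symm.le.trans ((herr n m).trans ?_)
      refine ENNReal.ofReal_le_ofReal (add_le_add le_rfl ?_)
      -- Only the competitors of the sent codeword count, so rounding the codebook size up costs
      -- nothing.
      have hK1 : (K n : ℝ) - 1 ≤ (2 : ℝ) ^ ((n : ℝ) * T * R) := by
        have := Nat.ceil_lt_add_one (a := (2 : ℝ) ^ ((n : ℝ) * T * R)) (by positivity)
        simp only [hK]; linarith
      have hp2 : p ^ (1 - δ) = 2 ^ ((1 - δ) * Real.logb 2 p) := by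
        rw [mul_comm, Real.rpow_mul zero_le_two, Real.rpow_logb two_pos (by norm_num) hp0]
      calc _ ≤ (2 : ℝ) ^ ((n : ℝ) * T * R) * (2 * p ^ (1 - δ)) ^ n :=
            mul_le_mul_of_nonneg_right hK1 (by positivity)
        _ = (2 ^ (T * R) * (2 * p ^ (1 - δ))) ^ n := by
            rw [mul_pow ((2 : ℝ) ^ (T * R)), ← Real.rpow_mul_natCast zero_le_two]
            congr 2
            ring
        _ = (2 ^ (T * R) * (2 ^ (1 : ℝ) * p ^ (1 - δ))) ^ n := by rw [Real.rpow_one]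
        _ = (2 ^ (-1 : ℝ)) ^ n := by
            -- Of the two bits subtracted in `hR`, one absorbs the Chernoff factor `2`, the other
            -- leaves the ratio `1 / 2`.
            have he : T * R + (1 + (1 - δ) * Real.logb 2 p) = -1 := by rw [hR]; ring
            rw [hp2, ← Real.rpow_add two_pos, ← Real.rpow_add two_pos, he]
        _ = _ := by rw [Real.rpow_neg_one, one_div]
    calc _ ≤ (K n : ℝ≥0∞)⁻¹ * ∑ _m : Fin (K n),
          ENNReal.ofReal (Real.exp (3 * q - δ) ^ n + (1 / 2) ^ n) := by
          unfold gaussianCodebookError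
          gcongr
          exact hm _
      _ = _ := by
          rw [Finset.sum_const, Finset.card_univ, Fintype.card_fin, nsmul_eq_mul, ← mul_assoc,
            ENNReal.inv_mul_cancel (by simpa using (hKpos n).ne') (by simp), one_mul]
  have h1 := tendsto_pow_atTop_nhds_zero_of_lt_one (Real.exp_pos _).le
    (Real.exp_lt_one_iff.2 (by linarith : 3 * q - δ < 0))
  have h2 := tendsto_pow_atTop_nhds_zero_of_lt_one (r := (1 / 2 : ℝ)) (by norm_num) (by norm_num)
  have h3 := ENNReal.tendsto_ofReal (h1.add h2)
  rw [add_zero, ENNReal.ofReal_zero] at h3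
  exact tendsto_of_tendsto_of_tendsto_of_le_of_le tendsto_const_nhds h3 (fun _ => zero_le) hE

/-- The bound on the probability that an independent Gaussian input passes the test, when the
direct and the cross links have amplitude `a` and `c`. -/
noncomputable def confusionBound (M T : ℕ) (L a c : ℝ) : ℝ :=
  (∏ i : Fin M, ∏ j : Fin M, (5 * (L * if i = j then a else c)) ^ 2) *
    ((2 * ((2 * M + 1) * L) / (a / (2 * L))) ^ 2) ^ (M * T)

theorem confusionBound_pos (M T : ℕ) {L a c : ℝ} (hL : 0 < L) (ha : 0 < a) (hc : 0 < c) :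
    0 < confusionBound M T L a c := by
  refine mul_pos (Finset.prod_pos fun i _ => Finset.prod_pos fun j _ => ?_) (by positivity)
  have : 0 < if i = j then a else c := by split_ifs <;> assumption
  positivity

theorem log_confusionBound (M T : ℕ) {L a c : ℝ} (hL : 0 < L) (ha : 0 < a) (hc : 0 < c) :
    Real.log (confusionBound M T L a c) =
      (2 * M ^ 2 * Real.log 5 + 2 * M * T * Real.log (4 * (2 * M + 1))) +
      (2 * M ^ 2 + 4 * M * T) * Real.log L +
      (2 * M - 2 * M * T) * Real.log a + 2 * M * (M - 1) * Real.log c := by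
  have hσ : ∀ i j : Fin M, 0 < if i = j then a else c := fun i j => by split_ifs <;> assumption
  have h1 : ∀ i j : Fin M, Real.log ((5 * (L * if i = j then a else c)) ^ 2) =
      2 * (Real.log 5 + Real.log L + Real.log c) +
        if i = j then 2 * (Real.log a - Real.log c) else 0 := by
    intro i j
    rw [Real.log_pow, Real.log_mul (by norm_num) (mul_pos hL (hσ i j)).ne',
      Real.log_mul hL.ne' (hσ i j).ne']
    split_ifs <;> push_cast <;> ring
  have h2 : 2 * ((2 * M + 1) * L) / (a / (2 * L)) = 4 * (2 * M + 1) * (L ^ 2 / a) := by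
    field_simp; ring
  rw [confusionBound, Real.log_mul ?_ (by positivity), Real.log_prod fun i _ => ?_, h2, Real.log_pow,
    Real.log_pow, Real.log_mul (by positivity) (by positivity), Real.log_div (by positivity) ha.ne',
    Real.log_pow]
  · have h3 : ∀ i : Fin M, Real.log (∏ j : Fin M, (5 * (L * if i = j then a else c)) ^ 2) =
        M * (2 * (Real.log 5 + Real.log L + Real.log c)) + 2 * (Real.log a - Real.log c) := by
      intro i
      rw [Real.log_prod fun j _ => by have := hσ i j; positivity]
      simp only [h1, Finset.sum_add_distrib]
      simp
    simp only [h3]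
    simp
    ring
  · exact Finset.prod_ne_zero_iff.2 fun j _ => by have := hσ i j; positivity
  · exact Finset.prod_ne_zero_iff.2 fun i _ => Finset.prod_ne_zero_iff.2 fun j _ => by
      have := hσ i j; positivity

/-- With `L = log s`, the `log L` terms and the constants are negligible against `log s`, so only
the exponents of the two amplitudes survive. -/
theorem tendsto_log_confusionBound (M T : ℕ) (γD γCL : ℝ) :
    Tendsto (fun s : ℝ => Real.log (confusionBound M T (Real.log s) (s ^ (γD / 2)) (s ^ (γCL / 2))) /
      Real.log s) atTop (𝓝 (-(M * ((T - 1) * γD - (M - 1) * γCL)))) := by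
  have h1 : Tendsto (fun s : ℝ => Real.log (Real.log s) / Real.log s) atTop (𝓝 0) :=
    (Real.isLittleO_log_id_atTop.tendsto_div_nhds_zero).comp Real.tendsto_log_atTop
  have h2 : Tendsto (fun s : ℝ => (2 * M ^ 2 * Real.log 5 + 2 * M * T * Real.log (4 * (2 * M + 1))) /
      Real.log s) atTop (𝓝 0) := tendsto_const_nhds.div_atTop Real.tendsto_log_atTop
  have h3 := (h2.add (h1.const_mul (2 * M ^ 2 + 4 * M * T : ℝ))).add_const
    ((2 * M - 2 * M * T) * (γD / 2) + 2 * M * (M - 1) * (γCL / 2))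
  have h4 : 0 + (2 * M ^ 2 + 4 * M * T : ℝ) * 0 +
      ((2 * M - 2 * M * T) * (γD / 2) + 2 * M * (M - 1) * (γCL / 2)) =
      -(M * ((T - 1) * γD - (M - 1) * γCL)) := by ring
  rw [h4] at h3
  refine h3.congr' ?_
  filter_upwards [eventually_gt_atTop 1] with s hs
  have hs0 : 0 < s := by linarith
  have hl := Real.log_pos hs
  rw [log_confusionBound M T hl (by positivity) (by positivity), Real.log_rpow hs0,
    Real.log_rpow hs0]
  field_simp
  ring

/-- The strict gap between the exponents beats every power of `log s`. -/
theorem eventually_dominant (M : ℕ) {γD γCL : ℝ} (hCL : 0 ≤ γCL) (hD : γCL < γD) :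
    ∀ᶠ s : ℝ in atTop, s ^ (γD / 2) / (2 * Real.log s) + 2 +
      M * (Real.log s * s ^ (γCL / 2) + 2) ≤ s ^ (γD / 2) / Real.log s := by
  have h := (isLittleO_log_rpow_atTop (r := (γD - γCL) / 4) (by linarith)).pow two_pos
  -- Since `L c ≥ 1`, the terms to be dominated are at most `(2 + 3 M) L c`, and the room available
  -- is `a / (2 L)`.
  have hC : (0 : ℝ) < 1 / (2 * (2 + 3 * M)) := by positivity
  filter_upwards [h.bound hC, eventually_ge_atTop (Real.exp 1)] with s hs hse
  have hs1 : 1 ≤ s := (Real.one_le_exp zero_le_one).trans hse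
  have hs0 : 0 < s := by linarith
  have hl : 1 ≤ Real.log s := by rwa [Real.le_log_iff_exp_le hs0]
  have hc : 1 ≤ s ^ (γCL / 2) := Real.one_le_rpow hs1 (by linarith)
  rw [Real.norm_of_nonneg (by positivity), Real.norm_of_nonneg (by positivity),
    ← Real.rpow_mul_natCast hs0.le, div_mul_eq_mul_div, one_mul, le_div_iff₀ (by positivity)] at hs
  have h1 : s ^ (γD / 2) = s ^ ((γD - γCL) / 4 * (2 : ℕ)) * s ^ (γCL / 2) := by
    rw [← Real.rpow_add hs0]; congr 1; push_cast; ring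
  have h2 : Real.log s ^ 2 * (2 * (2 + 3 * M)) * s ^ (γCL / 2) ≤ s ^ (γD / 2) := by
    rw [h1]; gcongr
  have h3 : 2 + M * (Real.log s * s ^ (γCL / 2) + 2) ≤
      (2 + 3 * M) * (Real.log s * s ^ (γCL / 2)) := by
    have : 1 ≤ Real.log s * s ^ (γCL / 2) := one_le_mul_of_one_le_of_one_le hl hc
    nlinarith [Nat.cast_nonneg (α := ℝ) M]
  have h4 : (2 + 3 * M) * (Real.log s * s ^ (γCL / 2)) ≤ s ^ (γD / 2) / (2 * Real.log s) := by
    rw [le_div_iff₀ (by positivity)]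
    linarith
  have h5 : s ^ (γD / 2) / Real.log s = s ^ (γD / 2) / (2 * Real.log s) +
      s ^ (γD / 2) / (2 * Real.log s) := by field_simp; norm_num
  linarith

theorem linkStrength_eq_sq (M : ℕ) (γD γCL : ℝ) {s : ℝ} (hs : 0 < s) (i j : Fin M) :
    (linkStrength M γD γCL s i j : ℝ) =
      (if i = j then s ^ (γD / 2) else s ^ (γCL / 2)) ^ 2 := by
  rw [linkStrength, Real.coe_toNNReal _ (by split_ifs <;> positivity)]
  split_ifs <;> rw [← Real.rpow_mul_natCast hs.le] <;> norm_num

/-- The generalized degrees of freedom of the noncoherent channel which i.i.d. Gaussian codebooks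
achieve. -/
theorem gaussianCodebooks_achieve_gDoF (M T : ℕ) (hM : 1 ≤ M) (hT : M < T) (γD γCL : ℝ)
    (hCL : 0 ≤ γCL) (hD : γCL < γD) :
    AchievesGDoF (GaussianCodebooksAchieveRate M T γD γCL)
      (M * ((1 - 1 / (T : ℝ)) * γD - ((M : ℝ) - 1) / T * γCL)) := by
  have hM1 : (1 : ℝ) ≤ M := by exact_mod_cast hM
  have hMT : (M : ℝ) + 1 ≤ T := by exact_mod_cast hT
  have hT0 : (0 : ℝ) < T := by linarith
  set p : ℝ → ℝ := fun s => confusionBound M T (Real.log s) (s ^ (γD / 2)) (s ^ (γCL / 2)) with hpdef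
  set q : ℝ → ℝ := fun s => (2 * (M * T) + M + M * M) / Real.log s ^ 2 with hqdef
  -- Just above the threshold `3 q`, yet tending to `0`, so that no gDoF is lost.
  set δ : ℝ → ℝ := fun s => 3 * q s + 1 / Real.log s with hδdef
  have hlim := tendsto_log_confusionBound M T γD γCL
  -- A positive exponent gives `p ≤ 1` eventually, as the random coding bound requires.
  have hpos : 0 < M * ((T - 1) * γD - (M - 1) * γCL) := by
    refine mul_pos (by linarith) ?_
    nlinarith
  refine ⟨fun s => ((1 - δ s) * (-Real.logb 2 (p s)) - 2) / T, ?_, ?_⟩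
  · filter_upwards [eventually_dominant M hCL hD, eventually_ge_atTop (Real.exp 1),
      hlim.eventually_lt_const (neg_lt_zero.2 hpos)] with s hdom hse hneg
    have hs1 : 1 ≤ s := (Real.one_le_exp zero_le_one).trans hse
    have hs0 : 0 < s := by linarith
    have hl : 1 ≤ Real.log s := by rwa [Real.le_log_iff_exp_le hs0]
    have hl0 : 0 < Real.log s := by linarith
    have ha : 0 < s ^ (γD / 2) := by positivity
    have hc : 0 < s ^ (γCL / 2) := by positivity
    have ha1 : 1 ≤ s ^ (γD / 2) := Real.one_le_rpow hs1 (by linarith)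
    have hc1 : 1 ≤ s ^ (γCL / 2) := Real.one_le_rpow hs1 (by linarith)
    have hp0 : 0 < p s := confusionBound_pos M T hl0 ha hc
    have hp1 : p s ≤ 1 := by
      rw [div_neg_iff] at hneg
      exact ((Real.log_neg_iff hp0).1 (by
        rcases hneg with h | h
        · linarith [h.2]
        · exact h.1)).le
    have hA : ∀ i j : Fin M, 1 ≤ Real.log s * if i = j then s ^ (γD / 2) else s ^ (γCL / 2) :=
      fun i j => one_le_mul_of_one_le_of_one_le hl (by split_ifs <;> assumption)
    refine gaussianCodebooksAchieveRate_of_test (measurableSet_closeTest M T _ _)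
      (q := q s) (p := p s) (δ := δ s) (by simp only [hqdef]; positivity) hp0 hp1
      (closeTest_compl_le hl ha hc hdom (linkStrength_eq_sq M γD γCL hs0))
      (fun y => gaussianMatrix_closeTest_le hA (by positivity) (by positivity) y)
      (by simp only [hδdef]; linarith [one_div_pos.2 hl0]) (by field_simp)
  · have hq : Tendsto q atTop (𝓝 0) := tendsto_const_nhds.div_atTop
      ((tendsto_pow_atTop two_ne_zero).comp Real.tendsto_log_atTop)
    have hinv : Tendsto (fun s => 1 / Real.log s) atTop (𝓝 0) :=
      tendsto_const_nhds.div_atTop Real.tendsto_log_atTop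
    have hδ : Tendsto δ atTop (𝓝 0) := by
      have := (hq.const_mul 3).add hinv
      rwa [mul_zero, add_zero] at this
    have h1 := ((((hδ.const_sub 1).mul hlim.neg).sub (hinv.const_mul (2 * Real.log 2))).div_const
      (T : ℝ))
    have h2 : ((1 - 0) * - -(M * (((T : ℝ) - 1) * γD - (M - 1) * γCL)) - 2 * Real.log 2 * 0) / T =
        M * ((1 - 1 / (T : ℝ)) * γD - ((M : ℝ) - 1) / T * γCL) := by
      field_simp; ring
    rw [h2] at h1
    refine h1.congr' ?_
    filter_upwards [eventually_gt_atTop 1] with s hs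
    have hl := Real.log_pos hs
    have hl2 := Real.log_pos (one_lt_two (α := ℝ))
    simp only [Real.logb, hpdef]
    field_simp

/-! ### Converse: received energy. -/

theorem norm_sq_sum_add_le {M : ℕ} (hM : 1 ≤ M) (z : Fin M → ℂ) (w : ℂ) :
    ‖∑ j, z j + w‖ ^ 2 ≤ 2 * M * (∑ j, ‖z j‖ ^ 2 + ‖w‖ ^ 2) := by
  have hM1 : (1 : ℝ) ≤ M := by exact_mod_cast hM
  have h1 : ‖∑ j, z j‖ ^ 2 ≤ M * ∑ j, ‖z j‖ ^ 2 := by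
    have h := sq_sum_le_card_mul_sum_sq (s := Finset.univ) (f := fun j => ‖z j‖)
    rw [Finset.card_univ, Fintype.card_fin] at h
    exact (pow_le_pow_left₀ (norm_nonneg _) (norm_sum_le _ _) 2).trans h
  have h2 := pow_le_pow_left₀ (norm_nonneg _) (norm_add_le (∑ j, z j) w) 2
  nlinarith [sq_nonneg (‖∑ j, z j‖ - ‖w‖), sq_nonneg ‖w‖]

theorem linkStrength_le (M : ℕ) {γD γCL s : ℝ} (hD : γCL ≤ γD) (hs : 1 ≤ s) (i j : Fin M) :
    (linkStrength M γD γCL s i j : ℝ≥0∞) ≤ ENNReal.ofReal (s ^ γD) := by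
  refine ENNReal.ofReal_le_ofReal ?_
  split_ifs
  · exact le_rfl
  · exact Real.rpow_le_rpow_of_exponent_le hs hD

/-- The mean energy of a received symbol is at most of the order of the energy sent times the
strength of the direct links. -/
theorem lintegral_received_le {M T n : ℕ} (hM : 1 ≤ M) {γD γCL s : ℝ} (hD : γCL ≤ γD) (hs : 1 ≤ s)
    (x : Fin n → CMatrix M T) (b : Fin n) (i : Fin M) (t : Fin T) :
    ∫⁻ ω, ENNReal.ofReal (‖received x ω.1 ω.2 b i t‖ ^ 2)
        ∂((fadingLaw M n γD γCL s).prod (noiseLaw M T n)) ≤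
      ENNReal.ofReal (2 * M * (∑ j, s ^ γD * ‖x b j t‖ ^ 2 + 1)) := by
  have hs0 : 0 < s := by linarith
  have hG : ∀ j, MeasurePreserving (fun ω : (Fin n → CMatrix M M) × (Fin n → CMatrix M T) =>
      ω.1 b i j) ((fadingLaw M n γD γCL s).prod (noiseLaw M T n))
      (complexGaussian (linkStrength M γD γCL s i j)) := fun j =>
    (measurePreserving_eval_gaussianMatrix _ i j).comp
      ((measurePreserving_eval (fun _ : Fin n => gaussianMatrix (linkStrength M γD γCL s)) b).comp
        measurePreserving_fst)
  have hW : MeasurePreserving (fun ω : (Fin n → CMatrix M M) × (Fin n → CMatrix M T) =>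
      ω.2 b i t) ((fadingLaw M n γD γCL s).prod (noiseLaw M T n)) (complexGaussian 1) :=
    (measurePreserving_eval_gaussianMatrix (fun _ _ => 1) i t).comp
      ((measurePreserving_eval
        (fun _ : Fin n => (gaussianMatrix fun _ _ => 1 : Measure (CMatrix M T))) b).comp
        measurePreserving_snd)
  have hm : Measurable fun z : ℂ => ENNReal.ofReal (‖z‖ ^ 2) := by fun_prop
  have hGi : ∀ j, ∫⁻ ω : (Fin n → CMatrix M M) × (Fin n → CMatrix M T),
      ENNReal.ofReal (‖ω.1 b i j‖ ^ 2) ∂((fadingLaw M n γD γCL s).prod (noiseLaw M T n)) ≤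
        ENNReal.ofReal (s ^ γD) := fun j => by
    have h := (hG j).lintegral_comp hm
    rw [lintegral_sq_complexGaussian] at h
    exact h.le.trans (linkStrength_le M hD hs i j)
  have hWi : ∫⁻ ω : (Fin n → CMatrix M M) × (Fin n → CMatrix M T),
      ENNReal.ofReal (‖ω.2 b i t‖ ^ 2) ∂((fadingLaw M n γD γCL s).prod (noiseLaw M T n)) = 1 := by
    have h := hW.lintegral_comp hm
    rwa [lintegral_sq_complexGaussian] at h
  calc _ ≤ ∫⁻ ω : (Fin n → CMatrix M M) × (Fin n → CMatrix M T), ENNReal.ofReal (2 * M) *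
        (∑ j, ENNReal.ofReal (‖x b j t‖ ^ 2) * ENNReal.ofReal (‖ω.1 b i j‖ ^ 2) +
          ENNReal.ofReal (‖ω.2 b i t‖ ^ 2))
        ∂((fadingLaw M n γD γCL s).prod (noiseLaw M T n)) := by
        refine lintegral_mono fun ω => ?_
        have h := norm_sq_sum_add_le hM (fun j => ω.1 b i j * x b j t) (ω.2 b i t)
        refine (ENNReal.ofReal_le_ofReal h).trans (le_of_eq ?_)
        rw [ENNReal.ofReal_mul (by positivity), ENNReal.ofReal_add
          (Finset.sum_nonneg fun _ _ => by positivity) (by positivity),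
          ENNReal.ofReal_sum_of_nonneg fun _ _ => by positivity]
        congr 3 with j
        rw [norm_mul, mul_pow, mul_comm, ENNReal.ofReal_mul (by positivity)]
    _ = ENNReal.ofReal (2 * M) * (∑ j, ENNReal.ofReal (‖x b j t‖ ^ 2) *
          ∫⁻ ω : (Fin n → CMatrix M M) × (Fin n → CMatrix M T), ENNReal.ofReal (‖ω.1 b i j‖ ^ 2)
            ∂((fadingLaw M n γD γCL s).prod (noiseLaw M T n)) + 1) := by
        rw [lintegral_const_mul _ (by fun_prop), lintegral_add_left (by fun_prop),
          lintegral_finsetSum _ (fun _ _ => by fun_prop), hWi]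
        congr 3 with j
        rw [lintegral_const_mul _ (by fun_prop)]
    _ ≤ ENNReal.ofReal (2 * M) * (∑ j, ENNReal.ofReal (‖x b j t‖ ^ 2) *
          ENNReal.ofReal (s ^ γD) + 1) := by
        gcongr with j _
        exact hGi j
    _ = _ := by
        rw [ENNReal.ofReal_mul (p := 2 * (M : ℝ)) (by positivity), ENNReal.ofReal_add
          (Finset.sum_nonneg fun _ _ => by positivity) zero_le_one,
          ENNReal.ofReal_sum_of_nonneg fun _ _ => by positivity, ENNReal.ofReal_one]
        congr 3 with j
        rw [mul_comm, ENNReal.ofReal_mul (by positivity)]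

/-- The energy received in the slots of a given set, over all antennas and coherence periods. -/
noncomputable def slotEnergy {M T n : ℕ} (S : Finset (Fin T)) (y : Fin n → CMatrix M T) : ℝ :=
  ∑ b, ∑ i, ∑ t ∈ S, ‖y b i t‖ ^ 2

theorem measurable_slotEnergy {M T n : ℕ} (S : Finset (Fin T)) :
    Measurable (slotEnergy (M := M) (n := n) S) := by
  unfold slotEnergy
  fun_prop

/-- On average over the messages, the received energy exceeds its order of magnitude with
probability at most one half. -/
theorem TrainingCode.sum_energy_gt_le {M T n K : ℕ} (c : TrainingCode M T n K) (hM : 1 ≤ M)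
    (hT : M < T) (hn : 0 < n) {γD γCL s : ℝ} (hD : γCL ≤ γD) (hD0 : 0 ≤ γD) (hs : 1 ≤ s)
    (S : Finset (Fin T)) :
    ∑ m, ((fadingLaw M n γD γCL s).prod (noiseLaw M T n))
      {ω | 4 * M * (M + 1) * (M * T) * n * s ^ γD ≤ slotEnergy S (received (c.codebook m) ω.1 ω.2)} ≤
      (K : ℝ≥0∞) * 2⁻¹ := by
  have hs0 : 0 < s := by linarith
  have hT0 : 0 < T := by omega
  have hσ : 1 ≤ s ^ γD := Real.one_le_rpow hs hD0
  -- Twice the bound on the mean energy averaged over messages, so that Markov's inequality yields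
  -- one half.
  set θ : ℝ := 4 * M * (M + 1) * (M * T) * n * s ^ γD with hθ
  have hθ0 : 0 < θ := by positivity
  have hrec : ∀ m, Measurable fun ω : (Fin n → CMatrix M M) × (Fin n → CMatrix M T) =>
      received (c.codebook m) ω.1 ω.2 := fun m =>
    measurable_received measurable_const measurable_fst measurable_snd
  have hmean : ∀ m, ∫⁻ ω, ENNReal.ofReal (slotEnergy S (received (c.codebook m) ω.1 ω.2))
      ∂((fadingLaw M n γD γCL s).prod (noiseLaw M T n)) ≤
      ENNReal.ofReal (∑ b, ∑ _i : Fin M, ∑ t,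
        2 * M * (∑ j, s ^ γD * ‖c.codebook m b j t‖ ^ 2 + 1)) := by
    intro m
    have h1 : ∀ ω : (Fin n → CMatrix M M) × (Fin n → CMatrix M T),
        ENNReal.ofReal (slotEnergy S (received (c.codebook m) ω.1 ω.2)) ≤ ∑ b, ∑ i, ∑ t,
        ENNReal.ofReal (‖received (c.codebook m) ω.1 ω.2 b i t‖ ^ 2) := by
      intro ω
      simp only [slotEnergy]
      rw [ENNReal.ofReal_sum_of_nonneg fun _ _ => by positivity]
      gcongr with b _
      rw [ENNReal.ofReal_sum_of_nonneg fun _ _ => by positivity]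
      gcongr with i _
      rw [ENNReal.ofReal_sum_of_nonneg fun _ _ => by positivity]
      exact Finset.sum_le_sum_of_subset (Finset.subset_univ S)
    have hm : ∀ b i t, Measurable fun ω : (Fin n → CMatrix M M) × (Fin n → CMatrix M T) =>
        ENNReal.ofReal (‖received (c.codebook m) ω.1 ω.2 b i t‖ ^ 2) := fun b i t => by
      have h := hrec m
      fun_prop
    refine (lintegral_mono h1).trans ?_
    rw [lintegral_finsetSum _ (fun b _ => Finset.measurable_fun_sum _ fun i _ =>
        Finset.measurable_fun_sum _ fun t _ => hm b i t),
      ENNReal.ofReal_sum_of_nonneg fun _ _ => by positivity]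
    gcongr with b _
    rw [lintegral_finsetSum _ (fun i _ => Finset.measurable_fun_sum _ fun t _ => hm b i t),
      ENNReal.ofReal_sum_of_nonneg fun _ _ => by positivity]
    gcongr with i _
    rw [lintegral_finsetSum _ (fun t _ => hm b i t),
      ENNReal.ofReal_sum_of_nonneg fun _ _ => by positivity]
    gcongr with t _
    exact lintegral_received_le hM hD hs _ b i t
  -- The power constraint averages over the codebook, so it can be used only after summing over the
  -- messages.
  have htotal : ∑ m, ∑ b, ∑ _i : Fin M, ∑ t,
      2 * M * (∑ j, s ^ γD * ‖c.codebook m b j t‖ ^ 2 + 1) ≤ K * 2⁻¹ * θ := by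
    have hp := c.power_le
    have h1 : ∑ m, ∑ b, ∑ _i : Fin M, ∑ t,
        2 * M * (∑ j, s ^ γD * ‖c.codebook m b j t‖ ^ 2 + 1) =
        2 * M * (M * s ^ γD * ∑ m, ∑ b, ∑ i, ∑ t, ‖c.codebook m b i t‖ ^ 2 + K * n * M * T) := by
      simp only [← Finset.mul_sum, Finset.sum_add_distrib, Finset.sum_const, Finset.card_univ,
        Fintype.card_fin, nsmul_eq_mul, mul_one]
      have h2 : ∀ m b, ∑ t, ∑ j, ‖c.codebook m b j t‖ ^ 2 = ∑ j, ∑ t, ‖c.codebook m b j t‖ ^ 2 :=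
        fun m b => Finset.sum_comm
      simp only [h2]
      ring
    rw [h1]
    have h3 : (M : ℝ) * s ^ γD * ∑ m, ∑ b, ∑ i, ∑ t, ‖c.codebook m b i t‖ ^ 2 + K * n * M * T ≤
        (M + 1) * s ^ γD * (K * n * M * T) := by
      have h4 : (M : ℝ) * s ^ γD * ∑ m, ∑ b, ∑ i, ∑ t, ‖c.codebook m b i t‖ ^ 2 ≤
          M * s ^ γD * (K * n * M * T) := by gcongr
      have h5 : (K : ℝ) * n * M * T ≤ s ^ γD * (K * n * M * T) :=
        le_mul_of_one_le_left (by positivity) hσ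
      linarith
    calc _ ≤ 2 * M * ((M + 1) * s ^ γD * (K * n * M * T)) := by gcongr
      _ = _ := by rw [hθ]; ring
  calc _ ≤ ∑ m, ENNReal.ofReal (∑ b, ∑ _i : Fin M, ∑ t,
        2 * M * (∑ j, s ^ γD * ‖c.codebook m b j t‖ ^ 2 + 1)) / ENNReal.ofReal θ := by
        refine Finset.sum_le_sum fun m _ => ?_
        have h := meas_ge_le_lintegral_div (μ := (fadingLaw M n γD γCL s).prod (noiseLaw M T n))
          (f := fun ω => ENNReal.ofReal (slotEnergy S (received (c.codebook m) ω.1 ω.2)))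
          ((measurable_slotEnergy S).comp (hrec m)).ennreal_ofReal.aemeasurable
          (ε := ENNReal.ofReal θ) (by simpa using hθ0) (by simp)
        refine (measure_mono fun ω hω => ?_).trans (h.trans (ENNReal.div_le_div_right (hmean m) _))
        exact ENNReal.ofReal_le_ofReal hω
    _ = ENNReal.ofReal (∑ m, ∑ b, ∑ _i : Fin M, ∑ t,
        2 * M * (∑ j, s ^ γD * ‖c.codebook m b j t‖ ^ 2 + 1)) / ENNReal.ofReal θ := by
        rw [ENNReal.ofReal_sum_of_nonneg fun _ _ => by positivity]
        simp only [div_eq_mul_inv, Finset.sum_mul]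
    _ ≤ ENNReal.ofReal (K * 2⁻¹ * θ) / ENNReal.ofReal θ :=
        ENNReal.div_le_div_right (ENNReal.ofReal_le_ofReal htotal) _
    _ = _ := by
        rw [← ENNReal.ofReal_div_of_pos hθ0, mul_div_cancel_right₀ _ hθ0.ne',
          ENNReal.ofReal_mul (Nat.cast_nonneg _), ENNReal.ofReal_natCast,
          ENNReal.ofReal_inv_of_pos two_pos, ENNReal.ofReal_ofNat]

/-! ### Converse: volume of the decoding regions. -/

theorem map_add_complexGaussian_le_volume (a : ℂ) :
    (complexGaussian 1).map (a + ·) ≤ ENNReal.ofReal (1 / Real.pi) • volume := by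
  have h := Measure.map_mono (complexGaussian_le_volume one_ne_zero) (measurable_const_add a)
  rwa [Measure.map_smul, map_add_left_eq_self (volume : Measure ℂ), NNReal.coe_one, mul_one] at h

/-- The law of the noise added to a fixed signal is dominated coordinate by coordinate. -/
theorem map_noiseLaw_le {M T n : ℕ} (a : Fin n → CMatrix M T)
    {ρ : Fin n → Fin M → Fin T → Measure ℂ}
    (hρ : ∀ b i t, (complexGaussian 1).map (a b i t + ·) ≤ ρ b i t) :
    (noiseLaw M T n).map (fun w b i t => a b i t + w b i t) ≤
      Measure.pi fun b => Measure.pi fun i => Measure.pi fun t => ρ b i t := by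
  have h1 : ∀ b i t, IsProbabilityMeasure ((complexGaussian 1).map (a b i t + ·)) := fun b i t =>
    Measure.isProbabilityMeasure_map (Measurable.aemeasurable (by fun_prop))
  have h2 : ∀ b i, IsProbabilityMeasure
      ((Measure.pi fun _ : Fin T => complexGaussian 1).map fun w t => a b i t + w t) := fun b i =>
    Measure.isProbabilityMeasure_map (Measurable.aemeasurable (by fun_prop))
  have h3 : ∀ b, IsProbabilityMeasure
      ((gaussianMatrix fun _ _ => 1 : Measure (CMatrix M T)).map fun w i t => a b i t + w i t) :=
    fun b => Measure.isProbabilityMeasure_map (Measurable.aemeasurable (by fun_prop))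
  rw [noiseLaw, Measure.pi_map_pi (f := fun b (w : CMatrix M T) i t => a b i t + w i t)
    fun b => Measurable.aemeasurable (by fun_prop)]
  refine measure_pi_mono fun b => ?_
  rw [gaussianMatrix, Measure.pi_map_pi (f := fun i (w : Fin T → ℂ) t => a b i t + w t)
    fun i => Measurable.aemeasurable (by fun_prop)]
  refine measure_pi_mono fun i => ?_
  rw [Measure.pi_map_pi (f := fun t (w : ℂ) => a b i t + w) fun t => by fun_prop]
  exact measure_pi_mono fun t => hρ b i t

theorem lintegral_pi_prod_pi_prod {M T n : ℕ} (ρ : Fin n → Fin M → Fin T → Measure ℂ)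
    [∀ b i t, SigmaFinite (ρ b i t)] (f : Fin n → Fin M → Fin T → ℂ → ℝ≥0∞)
    (hf : ∀ b i t, Measurable (f b i t)) :
    ∫⁻ y, ∏ b, ∏ i, ∏ t, f b i t (y b i t)
        ∂(Measure.pi fun b => Measure.pi fun i => Measure.pi fun t => ρ b i t) =
      ∏ b, ∏ i, ∏ t, ∫⁻ z, f b i t z ∂(ρ b i t) := by
  rw [lintegral_pi_prod (fun b => Measure.pi fun i => Measure.pi fun t => ρ b i t)
    (fun b y => ∏ i, ∏ t, f b i t (y i t)) fun b => by fun_prop]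
  refine Finset.prod_congr rfl fun b _ => ?_
  rw [lintegral_pi_prod (fun i => Measure.pi fun t => ρ b i t)
    (fun i y => ∏ t, f b i t (y t)) fun i => by fun_prop]
  exact Finset.prod_congr rfl fun i _ => lintegral_pi_prod (ρ b i) (f b i) (hf b i)

theorem lintegral_exp_neg_sq_div {v : ℝ} (hv : 0 < v) :
    ∫⁻ z : ℂ, ENNReal.ofReal (Real.exp (-(‖z‖ ^ 2 / v))) = ENNReal.ofReal (Real.pi * v) := by
  have h := GaussianFourier.integral_rexp_neg_mul_sq_norm (V := ℂ) (b := 1 / v) (by positivity)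
  rw [Complex.finrank_real_complex] at h
  have h2 : ∫ z : ℂ, Real.exp (-(‖z‖ ^ 2 / v)) = Real.pi * v := by
    calc _ = ∫ z : ℂ, Real.exp (-(1 / v) * ‖z‖ ^ 2) := by
          congr 1; ext z; congr 1; ring
      _ = _ := by rw [h]; norm_num
  rw [← h2, ofReal_integral_eq_lintegral_ofReal ?_ (ae_of_all _ fun _ => (Real.exp_pos _).le)]
  -- A non-integrable function would have integral `0`, but the value is positive.
  by_contra hcon
  rw [integral_undef hcon] at h2
  exact absurd h2 (mul_pos Real.pi_pos hv).ne

/-- The probability of decoding correctly at moderate received energy is small, summed over the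
messages: the decoding regions are disjoint, and their total volume is limited. -/
theorem sum_correct_le {M T n K : ℕ} {v θ : ℝ} (hv : 0 < v) (S : Finset (Fin T))
    (a : Fin K → Fin n → CMatrix M T) (ha : ∀ m m' b i, ∀ t ∉ S, a m b i t = a m' b i t)
    {d : (Fin n → CMatrix M T) → Fin K} (hd : Measurable d) :
    ∑ m, noiseLaw M T n {w | d (fun b i t => a m b i t + w b i t) = m ∧
        slotEnergy S (fun b i t => a m b i t + w b i t) ≤ θ} ≤
      ENNReal.ofReal (Real.exp (θ / v) * v ^ (n * M * S.card)) := by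
  classical
  obtain hK | hK := isEmpty_or_nonempty (Fin K)
  · simp
  obtain ⟨m₀⟩ := hK
  -- One measure dominates the output law of every message: scaled Lebesgue measure in the slots of
  -- `S`, and elsewhere the exact law, which by `ha` does not depend on the message. Only the slots
  -- of `S` thus contribute volume.
  let ρ : Fin n → Fin M → Fin T → Measure ℂ := fun b i t =>
    if t ∈ S then ENNReal.ofReal (1 / Real.pi) • volume
    else (complexGaussian 1).map (a m₀ b i t + ·)
  have hρσ : ∀ b i t, SigmaFinite (ρ b i t) := by
    intro b i t
    simp only [ρ]
    split_ifs
    · exact inferInstanceAs (SigmaFinite ((1 / Real.pi).toNNReal • (volume : Measure ℂ)))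
    · have : IsProbabilityMeasure ((complexGaussian 1).map (a m₀ b i t + ·)) :=
        Measure.isProbabilityMeasure_map (by fun_prop)
      infer_instance
  have hρ : ∀ m b i t, (complexGaussian 1).map (a m b i t + ·) ≤ ρ b i t := by
    intro m b i t
    simp only [ρ]
    split_ifs with h
    · exact map_add_complexGaussian_le_volume _
    · rw [ha m m₀ b i t h]
  set ν := Measure.pi fun b => Measure.pi fun i => Measure.pi fun t => ρ b i t
  have hmeas : ∀ m, MeasurableSet {y : Fin n → CMatrix M T | d y = m ∧ slotEnergy S y ≤ θ} :=
    fun m => (hd (measurableSet_singleton m)).inter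
      (measurableSet_le (measurable_slotEnergy S) measurable_const)
  -- A Gaussian weight replaces the volume of a high-dimensional ball: it factorizes, has mass `v`
  -- per coordinate in `S`, and is at least `exp (-θ / v)` where the energy is at most `θ`.
  let f : Fin n → Fin M → Fin T → ℂ → ℝ≥0∞ := fun _ _ t z =>
    if t ∈ S then ENNReal.ofReal (Real.exp (-(‖z‖ ^ 2 / v))) else 1
  have hf : ∀ b i t, Measurable (f b i t) := by
    intro b i t
    simp only [f]
    split_ifs <;> fun_prop
  have hfm : Measurable fun y : Fin n → CMatrix M T => ∏ b, ∏ i, ∏ t, f b i t (y b i t) := by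
    clear_value f
    fun_prop
  have hfρ : ∀ b i t, ∫⁻ z, f b i t z ∂(ρ b i t) = if t ∈ S then ENNReal.ofReal v else 1 := by
    intro b i t
    by_cases h : t ∈ S
    · simp only [f, ρ, h, if_true]
      rw [lintegral_smul_measure, lintegral_exp_neg_sq_div hv, smul_eq_mul,
        ← ENNReal.ofReal_mul (by positivity)]
      congr 1
      field_simp
    · have : IsProbabilityMeasure ((complexGaussian 1).map (a m₀ b i t + ·)) :=
        Measure.isProbabilityMeasure_map (by fun_prop)
      simp [f, ρ, h]
  have hprod : ∀ y : Fin n → CMatrix M T, ∏ b, ∏ i, ∏ t, f b i t (y b i t) =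
      ENNReal.ofReal (Real.exp (-(slotEnergy S y / v))) := by
    intro y
    have h1 : -(slotEnergy S y / v) = ∑ b, ∑ i, ∑ t ∈ S, -(‖y b i t‖ ^ 2 / v) := by
      simp only [slotEnergy, Finset.sum_neg_distrib, Finset.sum_div]
    rw [h1]
    simp only [Real.exp_sum]
    rw [ENNReal.ofReal_prod_of_nonneg fun _ _ => by positivity]
    refine Finset.prod_congr rfl fun b _ => ?_
    rw [ENNReal.ofReal_prod_of_nonneg fun _ _ => by positivity]
    refine Finset.prod_congr rfl fun i _ => ?_
    rw [ENNReal.ofReal_prod_of_nonneg fun _ _ => by positivity]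
    simp only [f, Finset.prod_ite_mem, Finset.univ_inter]
  calc _ ≤ ∑ m, ν {y | d y = m ∧ slotEnergy S y ≤ θ} := by
        refine Finset.sum_le_sum fun m _ => ?_
        refine le_trans ?_ (map_noiseLaw_le (a m) (hρ m) _)
        rw [Measure.map_apply (by fun_prop) (hmeas m)]
        rfl
    _ = ν (⋃ m ∈ Finset.univ, {y | d y = m ∧ slotEnergy S y ≤ θ}) := by
        rw [measure_biUnion_finset _ fun m _ => hmeas m]
        intro m _ m' _ hmm
        exact Set.disjoint_left.2 fun y h h' => hmm (h.1.symm.trans h'.1)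
    _ ≤ ν {y | ENNReal.ofReal (Real.exp (-(θ / v))) ≤ ∏ b, ∏ i, ∏ t, f b i t (y b i t)} := by
        refine measure_mono (Set.iUnion₂_subset fun m _ y hy => ?_)
        have h := hy.2
        rw [Set.mem_ofPred_eq, hprod]
        gcongr
    _ ≤ (∏ _b : Fin n, ∏ _i : Fin M, ∏ t : Fin T, if t ∈ S then ENNReal.ofReal v else 1) /
          ENNReal.ofReal (Real.exp (-(θ / v))) := by
        have h := meas_ge_le_lintegral_div (μ := ν)
          (f := fun y => ∏ b, ∏ i, ∏ t, f b i t (y b i t)) hfm.aemeasurable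
          (ε := ENNReal.ofReal (Real.exp (-(θ / v)))) (by simp; positivity) (by simp)
        rw [lintegral_pi_prod_pi_prod ρ f hf] at h
        simpa only [hfρ] using h
    _ = _ := by
        simp only [Finset.prod_ite_mem, Finset.univ_inter, Finset.prod_const, Finset.card_univ,
          Fintype.card_fin]
        rw [← ENNReal.ofReal_pow hv.le, ← ENNReal.ofReal_pow (by positivity),
          ← ENNReal.ofReal_pow (by positivity), ← ENNReal.ofReal_div_of_pos (by positivity),
          Real.exp_neg, div_inv_eq_mul, mul_comm, ← pow_mul, ← pow_mul]
        ring_nf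

/-! ### Converse: rates and gDoF of training codes. -/

/-- A lower bound on the error probability of a code with training. -/
theorem TrainingCode.one_le_error_add {M T n K : ℕ} (c : TrainingCode M T n K) (hM : 1 ≤ M)
    (hT : M < T) (hn : 0 < n) (hK : 0 < K) {γD γCL s : ℝ} (hD : γCL ≤ γD) (hD0 : 0 ≤ γD)
    (hs : 1 ≤ s) :
    1 ≤ c.error γD γCL s + 2⁻¹ + ENNReal.ofReal
      ((Real.exp (4 * M * (M + 1) * (M * T)) * (s ^ γD) ^ (M * (T - M))) ^ n / K) := by
  classical
  have hs0 : 0 < s := by linarith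
  set μ := (fadingLaw M n γD γCL s).prod (noiseLaw M T n) with hμ
  set θ : ℝ := 4 * M * (M + 1) * (M * T) * n * s ^ γD with hθ
  set S : Finset (Fin T) := (Finset.univ.map c.slot)ᶜ
  have hScard : S.card = T - M := by simp [S, Finset.card_compl]
  have hrec : ∀ m, Measurable fun ω : (Fin n → CMatrix M M) × (Fin n → CMatrix M T) =>
      received (c.codebook m) ω.1 ω.2 := fun m =>
    measurable_received measurable_const measurable_fst measurable_snd
  set Λ : ℝ := Real.exp (4 * M * (M + 1) * (M * T)) * (s ^ γD) ^ (M * (T - M))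
  have hcorrect : ∑ m, μ {ω | c.decoder (received (c.codebook m) ω.1 ω.2, ω.1) = m ∧
      slotEnergy S (received (c.codebook m) ω.1 ω.2) ≤ θ} ≤ ENNReal.ofReal (Λ ^ n) := by
    have hms : ∀ m, MeasurableSet {ω : (Fin n → CMatrix M M) × (Fin n → CMatrix M T) |
        c.decoder (received (c.codebook m) ω.1 ω.2, ω.1) = m ∧
          slotEnergy S (received (c.codebook m) ω.1 ω.2) ≤ θ} := fun m =>
      ((c.measurable_decoder.comp ((hrec m).prodMk measurable_fst))
        (measurableSet_singleton m)).inter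
        (measurableSet_le ((measurable_slotEnergy S).comp (hrec m)) measurable_const)
    -- With `v = s ^ γD` the exponent `θ / v` is `n` times a constant free of `s`, which is
    -- invisible to the gDoF.
    have hΛ : Real.exp (θ / s ^ γD) * (s ^ γD) ^ (n * M * S.card) = Λ ^ n := by
      have h1 : θ / s ^ γD = n * (4 * M * (M + 1) * (M * T)) := by
        rw [hθ]; field_simp
      rw [h1, Real.exp_nat_mul, hScard, mul_pow, ← pow_mul, mul_assoc n M, mul_comm n]
    calc _ = ∫⁻ g, ∑ m, noiseLaw M T n {w | c.decoder (received (c.codebook m) g w, g) = m ∧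
          slotEnergy S (received (c.codebook m) g w) ≤ θ} ∂(fadingLaw M n γD γCL s) := by
          refine Eq.trans ?_ (lintegral_finsetSum _ fun m _ =>
            measurable_measure_prodMk_left (hms m)).symm
          exact Finset.sum_congr rfl fun m _ => by rw [hμ, Measure.prod_apply (hms m)]
      _ ≤ ∫⁻ _, ENNReal.ofReal (Λ ^ n) ∂(fadingLaw M n γD γCL s) := by
          refine lintegral_mono fun g => ?_
          rw [← hΛ]
          refine sum_correct_le (by positivity) S
            (fun m b i t => ∑ j, g b i j * c.codebook m b j t) ?_
            (d := fun y => c.decoder (y, g))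
            (c.measurable_decoder.comp (measurable_id.prodMk measurable_const))
          intro m m' b i t ht
          obtain ⟨k, rfl⟩ : ∃ k, c.slot k = t := by simpa [S] using ht
          simp only [c.codebook_slot]
      _ = _ := by simp
  have hone : (K : ℝ≥0∞) ≤ ∑ m, μ {ω | c.decoder (received (c.codebook m) ω.1 ω.2, ω.1) ≠ m} +
      K * 2⁻¹ + ENNReal.ofReal (Λ ^ n) := by
    calc (K : ℝ≥0∞) = ∑ _m : Fin K, μ Set.univ := by simp
      _ ≤ ∑ m, (μ {ω | c.decoder (received (c.codebook m) ω.1 ω.2, ω.1) ≠ m} +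
            μ {ω | θ ≤ slotEnergy S (received (c.codebook m) ω.1 ω.2)} +
            μ {ω | c.decoder (received (c.codebook m) ω.1 ω.2, ω.1) = m ∧
              slotEnergy S (received (c.codebook m) ω.1 ω.2) ≤ θ}) := by
          refine Finset.sum_le_sum fun m _ => ?_
          refine le_trans (measure_mono fun ω _ => ?_)
            -- Every outcome is a decoding error, has high energy, or is decoded correctly at low
            -- energy.
            ((measure_union_le _ _).trans (add_le_add_left (measure_union_le _ _) _))
          by_cases h1 : c.decoder (received (c.codebook m) ω.1 ω.2, ω.1) = m
          · rcases le_total θ (slotEnergy S (received (c.codebook m) ω.1 ω.2)) with h2 | h2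
            · exact Or.inl (Or.inr h2)
            · exact Or.inr ⟨h1, h2⟩
          · exact Or.inl (Or.inl h1)
      _ ≤ _ := by
          rw [Finset.sum_add_distrib, Finset.sum_add_distrib]
          gcongr
          exact c.sum_energy_gt_le hM hT hn hD hD0 hs S
  have hK0 : (K : ℝ≥0∞) ≠ 0 := by simpa using hK.ne'
  have hKt : (K : ℝ≥0∞) ≠ ∞ := by simp
  calc (1 : ℝ≥0∞) = (K : ℝ≥0∞)⁻¹ * K := (ENNReal.inv_mul_cancel hK0 hKt).symm
    _ ≤ (K : ℝ≥0∞)⁻¹ * (∑ m, μ {ω | c.decoder (received (c.codebook m) ω.1 ω.2, ω.1) ≠ m} +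
      K * 2⁻¹ + ENNReal.ofReal (Λ ^ n)) := by gcongr
    _ = _ := by
        rw [mul_add, mul_add, ← mul_assoc, ENNReal.inv_mul_cancel hK0 hKt, one_mul,
          TrainingCode.error, ENNReal.ofReal_div_of_pos (by positivity), ENNReal.ofReal_natCast,
          ENNReal.div_eq_inv_mul]

/-- The rates of codes with training are limited. -/
theorem TrainingAchievesRate.le {M T : ℕ} (hM : 1 ≤ M) (hT : M < T) {γD γCL s R : ℝ}
    (hD : γCL ≤ γD) (hD0 : 0 ≤ γD) (hs : 1 ≤ s) (h : TrainingAchievesRate M T γD γCL s R) :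
    T * R * Real.log 2 ≤ 4 * M * (M + 1) * (M * T) + M * (T - M) * γD * Real.log s := by
  obtain ⟨K, code, hKR, herr⟩ := h
  have hs0 : 0 < s := by linarith
  set Λ : ℝ := Real.exp (4 * M * (M + 1) * (M * T)) * (s ^ γD) ^ (M * (T - M)) with hΛ
  have hΛ0 : 0 < Λ := by positivity
  have hlog : Real.log Λ = 4 * M * (M + 1) * (M * T) + M * (T - M) * γD * Real.log s := by
    rw [hΛ, Real.log_mul (by positivity) (by positivity), Real.log_exp, Real.log_pow,
      Real.log_rpow hs0]
    push_cast [Nat.cast_sub hT.le]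
    ring
  have hev : ∀ᶠ n : ℕ in atTop, ((2 : ℝ) ^ (T * R) / Λ) ^ n ≤ 4 := by
    -- An error below `1 / 4`, with the `1 / 2` lost to the energy, leaves at least `1 / 4` for the
    -- volume term.
    have h4 : (0 : ℝ≥0∞) < ENNReal.ofReal (1 / 4) := by simp
    filter_upwards [herr.eventually_lt_const h4, eventually_gt_atTop 0] with n hn hn0
    have hK : (0 : ℝ) < K n := lt_of_lt_of_le (by positivity) (hKR n)
    have h1 := (code n).one_le_error_add hM hT hn0 (by exact_mod_cast hK) hD hD0 hs
    have h2 : (1 : ℝ≥0∞) ≤ ENNReal.ofReal (1 / 4 + 1 / 2 + Λ ^ n / K n) := by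
      rw [ENNReal.ofReal_add (by positivity) (by positivity),
        ENNReal.ofReal_add (by positivity) (by positivity)]
      refine h1.trans ?_
      gcongr
      rw [one_div, ENNReal.ofReal_inv_of_pos two_pos, ENNReal.ofReal_ofNat]
    rw [ENNReal.one_le_ofReal] at h2
    have h3 : 1 / 4 ≤ Λ ^ n / K n := by linarith
    rw [le_div_iff₀ hK] at h3
    have h5 := hKR n
    have h6 : (2 : ℝ) ^ ((n : ℝ) * T * R) = (2 ^ (T * R)) ^ n := by
      rw [← Real.rpow_mul_natCast zero_le_two]
      congr 1
      ring
    rw [h6] at h5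
    rw [div_pow, div_le_iff₀ (by positivity)]
    linarith
  -- A ratio above `1` would have unbounded powers.
  have hle : (2 : ℝ) ^ (T * R) / Λ ≤ 1 := by
    by_contra! hcon
    obtain ⟨n, hn1, hn2⟩ := (hev.and
      ((tendsto_pow_atTop_atTop_of_one_lt hcon).eventually_gt_atTop 4)).exists
    linarith
  rw [div_le_one hΛ0] at hle
  rw [← hlog, ← Real.log_rpow two_pos]
  exact Real.log_le_log (by positivity) hle

/-- No more than `M (1 - M / T) γD` generalized degrees of freedom are achieved with training. -/
theorem training_gDoF_le {M T : ℕ} (hM : 1 ≤ M) (hT : M < T) {γD γCL : ℝ} (hD : γCL ≤ γD)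
    (hD0 : 0 ≤ γD) {d : ℝ} (hd : AchievesGDoF (TrainingAchievesRate M T γD γCL) d) :
    d ≤ M * (1 - (M : ℝ) / T) * γD := by
  obtain ⟨R, hR, hlim⟩ := hd
  have hT0 : (0 : ℝ) < T := by exact_mod_cast (by omega : 0 < T)
  have hinv : Tendsto (fun s => 1 / Real.log s) atTop (𝓝 0) :=
    tendsto_const_nhds.div_atTop Real.tendsto_log_atTop
  have hub := (hinv.const_mul (4 * M * (M + 1) * M : ℝ)).add_const (M * (1 - (M : ℝ) / T) * γD)
  rw [mul_zero, zero_add] at hub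
  refine le_of_tendsto_of_tendsto hlim hub ?_
  filter_upwards [hR, eventually_gt_atTop 1] with s hRs hs
  have h := hRs.le hM hT hD hD0 hs.le
  have hl := Real.log_pos hs
  have hl2 := Real.log_pos (one_lt_two (α := ℝ))
  rw [Real.logb, div_div_eq_mul_div, div_le_iff₀ hl]
  have h2 : (4 * M * (M + 1) * M * (1 / Real.log s) + M * (1 - (M : ℝ) / T) * γD) * Real.log s =
      (4 * M * (M + 1) * (M * T) + M * (T - M) * γD * Real.log s) / T := by
    field_simp
  rw [h2, le_div_iff₀ hT0]
  linarith

theorem theorem7 (M T : ℕ) (hM : 1 ≤ M) (hT : M < T) (γD γCL : ℝ) (hCL : 0 ≤ γCL)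
    (hD : γCL < γD) :
    AchievesGDoF (GaussianCodebooksAchieveRate M T γD γCL)
        (M * ((1 - 1 / (T : ℝ)) * γD - ((M : ℝ) - 1) / T * γCL)) ∧
      (∀ d : ℝ, AchievesGDoF (TrainingAchievesRate M T γD γCL) d →
        d ≤ M * (1 - (M : ℝ) / T) * γD) ∧
      (2 ≤ M → M * (1 - (M : ℝ) / T) * γD <
        M * ((1 - 1 / (T : ℝ)) * γD - ((M : ℝ) - 1) / T * γCL)) := by
  refine ⟨gaussianCodebooks_achieve_gDoF M T hM hT γD γCL hCL hD,
    fun d hd => training_gDoF_le hM hT hD.le (hCL.trans hD.le) hd, fun hM2 => ?_⟩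
  have hM2' : (2 : ℝ) ≤ M := by exact_mod_cast hM2
  have hT0 : (0 : ℝ) < T := by exact_mod_cast (by omega : 0 < T)
  have h : M * ((1 - 1 / (T : ℝ)) * γD - ((M : ℝ) - 1) / T * γCL) - M * (1 - (M : ℝ) / T) * γD =
      M * (M - 1) * (γD - γCL) / T := by
    field_simp
    ring
  have hpos : 0 < M * (M - 1) * (γD - γCL) / T :=
    div_pos (mul_pos (mul_pos (by linarith) (by linarith)) (by linarith)) hT0
  linarith
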